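/- **Setting.** Let $\mathsf{Pos}$ be the category of posets and monotone maps and let $T:\mathsf{Pos}\to\mathsf{Pos}$ be a finitary (filtered-colimit preserving), locally monotone functor that preserves exact squares and finite intersections of order-embeddings. (A lax square $f p_0\le g p_1$ is *exact* if $f(a)\le g(b)$ implies that there is $w$ with $a\le p_0(w)$ and $p_1(w)\le b$.) Put $T^\partial X=(T X^{op})^{op}$; let $\mathbb U_\omega X$ be the poset of finitely generated uppersets of $X$ ordered by reverse inclusion, and $\mathbb L_\omega X$ the poset of finitely generated lowersets ordered by inclusion; both act on maps by direct image followed by closure. A monotone relation $R:X\nrightarrow Y$ is a relation $R(y,x)$ that is downward closed in $y\in Y$ and upward closed in $x\in X$. Regarding $R$ as a subposet of $Y\times X$ with projections $q_0:R\to Y$, $q_1:R\to X$, the lifted relation $\overline T R:TX\nrightarrow TY$ is defined by: $\overline T R(b,a)$ iff there is $w\in T(R)$ with $b\le Tq_0(w)$ and $Tq_1(w)\le a$. For a functor $F:\mathsf{Pos}\to\mathsf{Pos}$ and $a\in FX$, the base $\mathrm{base}^F(a)$ is the least subposet $S\subseteq X$ such that $a$ is in the image of $FS\to FX$, that is, the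 intersection of all such $S$. **Logic.** Fix a poset $\mathsf{At}$ of atoms. The poset $\mathcal L$ of formulas is the free algebra on $\mathsf{At}$ for $\mathbb U_\omega+\mathbb L_\omega+T^\partial+T^\partial$ in $\mathsf{Pos}$, with operations $\bigwedge,\bigvee,\nabla,\Delta$. Given a coalgebra $c:X\to TX$ and a monotone valuation $\mathsf{At}\nrightarrow X^{op}$, the monotone relation $\Vdash:\mathcal L\nrightarrow X^{op}$ extends the valuation by: $x\Vdash\bigwedge\phi$ iff $x\Vdash a$ for all $a\in\phi$; $x\Vdash\bigvee\psi$ iff $x\Vdash a$ for some $a\in\psi$; $x\Vdash\nabla\alpha$ iff $c(x)\mathrel{\overline{T^\partial}{\Vdash}}\alpha$; and $x\nVdash\Delta\beta$ iff $c(x)\mathrel{\overline{T}{\nVdash}}\beta$, where $\nVdash:\mathcal L^{op}\nrightarrow X$. A sequent $\phi\Rightarrow\psi$ consists of $\phi\in\mathbb U_\omega\mathcal L$ and $\psi\in\mathbb L_\omega\mathcal L$; it is *refutable* if there are a coalgebra for $T$, a monotone valuation and a state $x$ with $x\Vdash\bigwedge\phi$ and $x\nVdash\bigvee\psi$. **Redistributions.**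 Let $A\in\mathbb U_\omega T^\partial\mathcal L$ and $B\in\mathbb L_\omega T^\partial\mathcal L$, with $V=\mathrm{base}^{\mathbb U_\omega T^\partial}(A)\subseteq\mathcal L$ and $W=\mathrm{base}^{\mathbb L_\omega T^\partial}(B)\subseteq\mathcal L$. Let $p_0,p_1$ be the projections of $\mathbb U_\omega\mathcal L\times\mathbb L_\omega\mathcal L$. A *redistribution* of $(A,B)$ is an element $\Phi\in T^\partial(\mathbb U_\omega\mathcal L\times\mathbb L_\omega\mathcal L)$ that lies in (the image of) $T^\partial(\mathbb U_\omega V\times\mathbb L_\omega W)$ and satisfies $(T^\partial p_0)\Phi\mathrel{\overline{T^\partial}{\ni}}\alpha$ for all $\alpha\in A$ and $\beta\mathrel{\overline{T^\partial}{\in}}(T^\partial p_1)\Phi$ for all $\beta\in B$, where $\ni:\mathcal L\nrightarrow\mathbb U_\omega\mathcal L$ and $\in:\mathbb L_\omega\mathcal L\nrightarrow\mathcal L$ are the membership relations. **Proposition.** Let $A$ and $B$ be as above, and let $\pi\in\mathbb U_\omega\mathcal L$ and $\lambda\in\mathbb L_\omega\mathcal L$ consist of atoms. The following are equivalent: 1.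 The sequent $\pi,\{\nabla\alpha\mid\alpha\in A\}\Rightarrow\{\Delta\beta\mid\beta\in B\},\lambda$ is refutable (commas and braces denote the generated upperset, respectively lowerset). 2. The sequent $\pi\Rightarrow\lambda$ is refutable, and there is a redistribution $\Phi$ of $(A,B)$ such that for every $z\in\mathrm{base}^{T^\partial}(\Phi)\subseteq\mathbb U_\omega\mathcal L\times\mathbb L_\omega\mathcal L$ the sequent $p_0(z)\Rightarrow p_1(z)$ is refutable. -/

import Mathlib

open CategoryTheory CategoryTheory.Limits CategoryTheory.Endofunctor

universe u

namespace MossLogic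

/-! ## Posets and functors on posets -/

/-- A lax square `f ∘ p₀ ≤ g ∘ p₁` of monotone maps that is exact. -/
def ExactSquare {P A B C : PartOrd.{u}} (p₀ : P ⟶ A) (p₁ : P ⟶ B) (f : A ⟶ C) (g : B ⟶ C) :
    Prop :=
  (∀ w : P, f (p₀ w) ≤ g (p₁ w)) ∧
    ∀ (a : A) (b : B), f a ≤ g b → ∃ w : P, a ≤ p₀ w ∧ p₁ w ≤ b

/-- Monotone maps that reflect the order. -/
def IsOrderEmb {X Y : PartOrd.{u}} (f : X ⟶ Y) : Prop :=
  ∀ a b : X, f a ≤ f b → a ≤ b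

/-- The standing assumptions on the coalgebra functor: it is finitary and locally monotone, and
it preserves exact squares and finite intersections (pullbacks) of order embeddings. -/
class IsMossFunctor (T : PartOrd.{u} ⥤ PartOrd.{u}) : Prop where
  finitary : PreservesFilteredColimits T
  locallyMonotone : ∀ {X Y : PartOrd.{u}} (f g : X ⟶ Y), (∀ x : X, f x ≤ g x) →
    ∀ a : T.obj X, T.map f a ≤ T.map g a
  exact : ∀ {P A B C : PartOrd.{u}} (p₀ : P ⟶ A) (p₁ : P ⟶ B) (f : A ⟶ C) (g : B ⟶ C),
    ExactSquare p₀ p₁ f g → ExactSquare (T.map p₀) (T.map p₁) (T.map f) (T.map g)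
  inter : ∀ {P A B C : PartOrd.{u}} (p₀ : P ⟶ A) (p₁ : P ⟶ B) (f : A ⟶ C) (g : B ⟶ C),
    IsOrderEmb f → IsOrderEmb g → IsPullback p₀ p₁ f g →
      IsPullback (T.map p₀) (T.map p₁) (T.map f) (T.map g)

/-- The dual poset `X^op`. -/
abbrev opPos (X : PartOrd.{u}) : PartOrd.{u} := PartOrd.of Xᵒᵈ

/-- An element of `X` as an element of `X^op`. -/
def toOp {X : PartOrd.{u}} (x : X) : opPos X := OrderDual.toDual (x : X.carrier)

/-- An element of `X^op` as an element of `X`. -/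
def ofOp {X : PartOrd.{u}} (x : opPos X) : X := OrderDual.ofDual (α := X.carrier) x

/-- The dual functor `T^∂ X = (T X^op)^op`. -/
abbrev dualFunctor (T : PartOrd.{u} ⥤ PartOrd.{u}) : PartOrd.{u} ⥤ PartOrd.{u} :=
  PartOrd.dual ⋙ T ⋙ PartOrd.dual

theorem IsMossFunctor.exact_dual (T : PartOrd.{u} ⥤ PartOrd.{u}) [hT : IsMossFunctor T]
    {P A B C : PartOrd.{u}} (p₀ : P ⟶ A) (p₁ : P ⟶ B) (f : A ⟶ C) (g : B ⟶ C)
    (h : ExactSquare p₀ p₁ f g) :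
    ExactSquare ((dualFunctor T).map p₀) ((dualFunctor T).map p₁) ((dualFunctor T).map f)
      ((dualFunctor T).map g) := by
  have hd : ExactSquare (PartOrd.dual.map p₁) (PartOrd.dual.map p₀) (PartOrd.dual.map g)
      (PartOrd.dual.map f) :=
    ⟨fun w => h.1 w, fun b a hab => by
      obtain ⟨w, h1, h2⟩ := h.2 a b hab
      exact ⟨w, h2, h1⟩⟩
  have h' := hT.exact _ _ _ _ hd
  exact ⟨fun w => h'.1 w, fun a b hab => by
    obtain ⟨w, h1, h2⟩ := h'.2 b a hab
    exact ⟨w, h2, h1⟩⟩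

/-- Finitely generated upper sets, ordered by reverse inclusion (the order of `UpperSet`). -/
abbrev UpFin (X : Type u) [PartialOrder X] : Type u :=
  {φ : UpperSet X // ∃ s : Set X, s.Finite ∧ φ = upperClosure s}

/-- Finitely generated lower sets, ordered by inclusion. -/
abbrev LowFin (X : Type u) [PartialOrder X] : Type u :=
  {ψ : LowerSet X // ∃ s : Set X, s.Finite ∧ ψ = lowerClosure s}

theorem upperClosure_image {X Y : Type u} [PartialOrder X] [PartialOrder Y] (f : X →o Y)
    (s : Set X) : upperClosure (f '' (upperClosure s : Set X)) = upperClosure (f '' s) := by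
  ext y
  simp only [SetLike.mem_coe, mem_upperClosure, Set.mem_image]
  constructor
  · rintro ⟨_, ⟨a, ⟨b, hb, hba⟩, rfl⟩, h⟩
    exact ⟨f b, ⟨b, hb, rfl⟩, (f.monotone hba).trans h⟩
  · rintro ⟨_, ⟨b, hb, rfl⟩, h⟩
    exact ⟨f b, ⟨b, ⟨b, hb, le_rfl⟩, rfl⟩, h⟩

theorem lowerClosure_image {X Y : Type u} [PartialOrder X] [PartialOrder Y] (f : X →o Y)
    (s : Set X) : lowerClosure (f '' (lowerClosure s : Set X)) = lowerClosure (f '' s) := by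
  ext y
  simp only [SetLike.mem_coe, mem_lowerClosure, Set.mem_image]
  constructor
  · rintro ⟨_, ⟨a, ⟨b, hb, hba⟩, rfl⟩, h⟩
    exact ⟨f b, ⟨b, hb, rfl⟩, h.trans (f.monotone hba)⟩
  · rintro ⟨_, ⟨b, hb, rfl⟩, h⟩
    exact ⟨f b, ⟨b, ⟨b, hb, le_rfl⟩, rfl⟩, h⟩

/-- `φ ↦ ↑f[φ]`. -/
def UpFin.map {X Y : Type u} [PartialOrder X] [PartialOrder Y] (f : X →o Y) :
    UpFin X →o UpFin Y where
  toFun φ := ⟨upperClosure (f '' (φ.1 : Set X)), by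
    obtain ⟨s, hs, h⟩ := φ.2
    exact ⟨f '' s, hs.image f, by rw [h, upperClosure_image]⟩⟩
  monotone' φ φ' h := upperClosure_anti (Set.image_mono h)

/-- `ψ ↦ ↓f[ψ]`. -/
def LowFin.map {X Y : Type u} [PartialOrder X] [PartialOrder Y] (f : X →o Y) :
    LowFin X →o LowFin Y where
  toFun ψ := ⟨lowerClosure (f '' (ψ.1 : Set X)), by
    obtain ⟨s, hs, h⟩ := ψ.2
    exact ⟨f '' s, hs.image f, by rw [h, lowerClosure_image]⟩⟩
  monotone' ψ ψ' h := lowerClosure_mono (Set.image_mono h)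

/-- The finitary upperset functor `𝕌_ω`. -/
def upFunctor : PartOrd.{u} ⥤ PartOrd.{u} where
  obj X := PartOrd.of (UpFin X)
  map f := PartOrd.ofHom (UpFin.map f.hom)
  map_id X := by
    refine PartOrd.ext fun φ => Subtype.ext ?_
    change upperClosure (_ '' (φ.1 : Set X)) = φ.1
    simp
  map_comp {X Y Z} f g := by
    refine PartOrd.ext fun φ => Subtype.ext ?_
    change upperClosure _ = upperClosure (g.hom '' (upperClosure (f.hom '' (φ.1 : Set X)) : Set Y))
    rw [upperClosure_image, Set.image_image]
    rfl

/-- The finitary lowerset functor `𝕃_ω`. -/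
def lowFunctor : PartOrd.{u} ⥤ PartOrd.{u} where
  obj X := PartOrd.of (LowFin X)
  map f := PartOrd.ofHom (LowFin.map f.hom)
  map_id X := by
    refine PartOrd.ext fun ψ => Subtype.ext ?_
    change lowerClosure (_ '' (ψ.1 : Set X)) = ψ.1
    simp
  map_comp {X Y Z} f g := by
    refine PartOrd.ext fun ψ => Subtype.ext ?_
    change lowerClosure _ = lowerClosure (g.hom '' (lowerClosure (f.hom '' (ψ.1 : Set X)) : Set Y))
    rw [lowerClosure_image, Set.image_image]
    rfl

/-- The union `φ, φ'` of two finitely generated upper sets. -/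
def UpFin.union {X : Type u} [PartialOrder X] (φ φ' : UpFin X) : UpFin X :=
  ⟨φ.1 ⊓ φ'.1, by
    obtain ⟨s, hs, h⟩ := φ.2
    obtain ⟨t, ht, h'⟩ := φ'.2
    exact ⟨s ∪ t, hs.union ht, by rw [h, h', upperClosure_union]⟩⟩

/-- The union `ψ, ψ'` of two finitely generated lower sets. -/
def LowFin.union {X : Type u} [PartialOrder X] (ψ ψ' : LowFin X) : LowFin X :=
  ⟨ψ.1 ⊔ ψ'.1, by
    obtain ⟨s, hs, h⟩ := ψ.2
    obtain ⟨t, ht, h'⟩ := ψ'.2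
    exact ⟨s ∪ t, hs.union ht, by rw [h, h', lowerClosure_union]⟩⟩

/-- The product of two posets, with the componentwise order. -/
abbrev prodPos (X Y : PartOrd.{u}) : PartOrd.{u} := PartOrd.of (X × Y)

abbrev prodFst (X Y : PartOrd.{u}) : prodPos X Y ⟶ X := PartOrd.ofHom OrderHom.fst

abbrev prodSnd (X Y : PartOrd.{u}) : prodPos X Y ⟶ Y := PartOrd.ofHom OrderHom.snd

abbrev prodPosMap {X Y X' Y' : PartOrd.{u}} (f : X ⟶ X') (g : Y ⟶ Y') : prodPos X Y ⟶ prodPos X' Y' :=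
  PartOrd.ofHom (OrderHom.prodMap f.hom g.hom)

/-! ## Bases -/

/-- A subset of a poset as a poset with the induced order. Up to equivalence, these are exactly
the subobjects given by order embeddings. -/
abbrev subPos {X : PartOrd.{u}} (S : Set X) : PartOrd.{u} := PartOrd.of S

/-- The inclusion of a subset. -/
abbrev incl {X : PartOrd.{u}} (S : Set X) : subPos S ⟶ X :=
  PartOrd.ofHom (OrderHom.Subtype.val (· ∈ S))

/-- The element `α` of `F X` belongs to the subobject `F S` of `F X`. -/
def MemSub (F : PartOrd.{u} ⥤ PartOrd.{u}) {X : PartOrd.{u}} (α : F.obj X) (S : Set X) : Prop :=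
  ∃ w : F.obj (subPos S), F.map (incl S) w = α

/-- The subobject `V` of `X` is a base of the element `α : 1 → F X`. -/
def IsBase (F : PartOrd.{u} ⥤ PartOrd.{u}) {X : PartOrd.{u}} (α : F.obj X) (V : Set X) : Prop :=
  ∀ S : Set X, V ⊆ S ↔ MemSub F α S

/-- The base of an element of `F X`, as the intersection of all subobjects `S` of `X` with
`α ∈ F S`. -/
def base (F : PartOrd.{u} ⥤ PartOrd.{u}) {X : PartOrd.{u}} (α : F.obj X) : Set X :=
  ⋂₀ {S | MemSub F α S}

theorem IsBase.eq_base {F : PartOrd.{u} ⥤ PartOrd.{u}} {X : PartOrd.{u}} {α : F.obj X}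
    {V : Set X} (h : IsBase F α V) : V = base F α :=
  Set.Subset.antisymm (Set.subset_sInter fun S hS => (h S).2 hS)
    (Set.sInter_subset_of_mem ((h V).1 subset_rfl))

/-! ## Monotone relations and their lifting -/

/-- A monotone relation from `X` to `Y`; `R.rel y x` means `y R x`. -/
structure MonRel (X Y : PartOrd.{u}) where
  rel : Y → X → Prop
  mono : ∀ {y y' : Y} {x x' : X}, rel y x → y' ≤ y → x ≤ x' → rel y' x'

namespace MonRel

/-- The restriction `R(-, f-)`. -/
def restrict {A X Y : PartOrd.{u}} (R : MonRel X Y) (f : A ⟶ X) : MonRel A Y where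
  rel y a := R.rel y (f a)
  mono h hy ha := R.mono h hy (f.hom.monotone ha)

/-- The poset of related pairs. -/
abbrev graph {X Y : PartOrd.{u}} (R : MonRel X Y) : PartOrd.{u} :=
  subPos (X := prodPos Y X) {p | R.rel p.1 p.2}

/-- The relation lifting `T̄R : T X ⇸ T Y`, computed from the span of projections of the graph:
`T̄R(β, α)` iff there is `w ∈ T(graph R)` with `β ≤ T p₀ (w)` and `T p₁ (w) ≤ α`. -/
def lift (T : PartOrd.{u} ⥤ PartOrd.{u}) {X Y : PartOrd.{u}} (R : MonRel X Y) :
    MonRel (T.obj X) (T.obj Y) where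
  rel β α := ∃ w : T.obj R.graph,
    β ≤ T.map (incl _ ≫ prodFst Y X) w ∧ T.map (incl _ ≫ prodSnd Y X) w ≤ α
  mono := by
    rintro β β' α α' ⟨w, h1, h2⟩ hβ hα
    exact ⟨w, hβ.trans h1, h2.trans hα⟩

/-- Relation lifting commutes with restrictions. -/
theorem lift_restrict {T : PartOrd.{u} ⥤ PartOrd.{u}}
    (hT : ∀ {P A B C : PartOrd.{u}} (p₀ : P ⟶ A) (p₁ : P ⟶ B) (f : A ⟶ C) (g : B ⟶ C),
      ExactSquare p₀ p₁ f g → ExactSquare (T.map p₀) (T.map p₁) (T.map f) (T.map g))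
    {A X Y : PartOrd.{u}} (R : MonRel X Y) (f : A ⟶ X) (β : T.obj Y) (α : T.obj A) :
    (R.lift T).rel β (T.map f α) ↔ ((R.restrict f).lift T).rel β α := by
  have mapmap : ∀ {U V W : PartOrd.{u}} (g : U ⟶ V) (h : V ⟶ W) (a : T.obj U),
      T.map h (T.map g a) = T.map (g ≫ h) a := fun g h a => by
    rw [← ConcreteCategory.comp_apply, ← T.map_comp]
  constructor
  · rintro ⟨w, h1, h2⟩
    let P : PartOrd.{u} := subPos (X := prodPos R.graph A) {q | q.1.1.2 ≤ f q.2}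
    let q₀ : P ⟶ R.graph := incl _ ≫ prodFst R.graph A
    let q₁ : P ⟶ A := incl _ ≫ prodSnd R.graph A
    have hex : ExactSquare q₀ q₁ (incl _ ≫ prodSnd Y X) f :=
      ⟨fun q => q.2, fun e a h => ⟨⟨(e, a), h⟩, le_rfl, le_rfl⟩⟩
    obtain ⟨v, hv1, hv2⟩ := (hT _ _ _ _ hex).2 w α h2
    let k : P ⟶ (R.restrict f).graph := PartOrd.ofHom
      { toFun := fun q => ⟨(q.1.1.1.1, q.1.2), R.mono q.1.1.2 le_rfl q.2⟩
        monotone' := fun q q' h => ⟨h.1.1, h.2⟩ }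
    refine ⟨T.map k v, ?_, ?_⟩
    · rw [mapmap]
      refine h1.trans (((T.map (incl _ ≫ prodFst Y X)).hom.monotone hv1).trans (le_of_eq ?_))
      exact mapmap q₀ (incl _ ≫ prodFst Y X) v
    · rw [mapmap]
      exact hv2
  · rintro ⟨w, h1, h2⟩
    let k : (R.restrict f).graph ⟶ R.graph := PartOrd.ofHom
      { toFun := fun q => ⟨(q.1.1, f q.1.2), q.2⟩
        monotone' := fun q q' h => ⟨h.1, f.hom.monotone h.2⟩ }
    refine ⟨T.map k w, ?_, ?_⟩
    · rw [mapmap]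
      exact h1
    · rw [mapmap]
      refine le_trans (le_of_eq ?_) ((T.map f).hom.monotone h2)
      exact (mapmap (incl _ ≫ prodSnd Y A) f w).symm

end MonRel

/-- Membership `∋ : X ⇸ 𝕌_ω X`. -/
def memUp (X : PartOrd.{u}) : MonRel X (upFunctor.obj X) where
  rel φ x := x ∈ φ.1
  mono {φ _ _ _} h hφ hx := hφ (φ.1.upper hx h)

/-- Membership `∈ : 𝕃_ω X ⇸ X`. -/
def memLow (X : PartOrd.{u}) : MonRel (lowFunctor.obj X) X where
  rel x ψ := x ∈ ψ.1
  mono {_ _ ψ _} h hx hψ := hψ (ψ.1.lower hx h)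

/-- The sum of two functors, formed with the disjoint sum of posets. -/
def sumFunctor (F G : PartOrd.{u} ⥤ PartOrd.{u}) : PartOrd.{u} ⥤ PartOrd.{u} where
  obj X := PartOrd.of (F.obj X ⊕ G.obj X)
  map {X Y} f := PartOrd.ofHom
    { toFun := Sum.map (F.map f) (G.map f)
      monotone' := by
        rintro (a | a) (b | b) h
        · exact Sum.inl_le_inl_iff.2 ((F.map f).hom.monotone (Sum.inl_le_inl_iff.1 h))
        · exact absurd h Sum.not_inl_le_inr
        · exact absurd h Sum.not_inr_le_inl
        · exact Sum.inr_le_inr_iff.2 ((G.map f).hom.monotone (Sum.inr_le_inr_iff.1 h)) }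
  map_id X := by
    refine PartOrd.ext ?_
    rintro (a | a)
    · exact congrArg Sum.inl (by rw [F.map_id]; rfl)
    · exact congrArg Sum.inr (by rw [G.map_id]; rfl)
  map_comp f g := by
    refine PartOrd.ext ?_
    rintro (a | a)
    · exact congrArg Sum.inl (by rw [F.map_comp]; rfl)
    · exact congrArg Sum.inr (by rw [G.map_comp]; rfl)

/-- The injection of the first summand. -/
def sumInl (F G : PartOrd.{u} ⥤ PartOrd.{u}) (X : PartOrd.{u}) :
    F.obj X ⟶ (sumFunctor F G).obj X :=
  PartOrd.ofHom { toFun := Sum.inl, monotone' := fun _ _ h => Sum.inl_le_inl_iff.2 h }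

/-- The injection of the second summand. -/
def sumInr (F G : PartOrd.{u} ⥤ PartOrd.{u}) (X : PartOrd.{u}) :
    G.obj X ⟶ (sumFunctor F G).obj X :=
  PartOrd.ofHom { toFun := Sum.inr, monotone' := fun _ _ h => Sum.inr_le_inr_iff.2 h }

/-- The map out of a sum given by maps out of the summands. -/
def sumDesc {F G : PartOrd.{u} ⥤ PartOrd.{u}} {X Z : PartOrd.{u}} (f : F.obj X ⟶ Z)
    (g : G.obj X ⟶ Z) : (sumFunctor F G).obj X ⟶ Z :=
  PartOrd.ofHom
    { toFun := fun a => Sum.elim f g a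
      monotone' := by
        rintro (a | a) (b | b) h
        · exact f.hom.monotone (Sum.inl_le_inl_iff.1 h)
        · exact absurd h Sum.not_inl_le_inr
        · exact absurd h Sum.not_inr_le_inl
        · exact g.hom.monotone (Sum.inr_le_inr_iff.1 h) }

/-- The functor `At + 𝕌_ω + 𝕃_ω + T^∂ + T^∂`; its summands are the arities of atoms, `⋀`, `⋁`,
`∇` and `Δ`. -/
abbrev langFunctor (T : PartOrd.{u} ⥤ PartOrd.{u}) (At : PartOrd.{u}) :
    PartOrd.{u} ⥤ PartOrd.{u} :=
  sumFunctor ((Functor.const PartOrd).obj At) (sumFunctor upFunctor (sumFunctor lowFunctor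
    (sumFunctor (dualFunctor T) (dualFunctor T))))

/-! ## Existence of the language

Colimits of countable chains of posets and the construction of initial algebras. -/

structure IsChainColimit {D : ℕ ⥤ PartOrd.{u}} (c : Cocone D) : Prop where
  surj : ∀ y : c.pt, ∃ (n : ℕ) (a : D.obj n), c.ι.app n a = y
  refl : ∀ (n : ℕ) (a b : D.obj n), c.ι.app n a ≤ c.ι.app n b →
    ∃ (m : ℕ) (h : n ≤ m), D.map (homOfLE h) a ≤ D.map (homOfLE h) b

section chain
variable {D : ℕ ⥤ PartOrd.{u}}

theorem map_map_apply {i j k : ℕ} (h : i ≤ j) (h' : j ≤ k) (a : D.obj i) :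
    D.map (homOfLE h') (D.map (homOfLE h) a) = D.map (homOfLE (h.trans h')) a := by
  rw [← ConcreteCategory.comp_apply, ← D.map_comp]; rfl

theorem cocone_apply (c : Cocone D) {i j : ℕ} (h : i ≤ j) (a : D.obj i) :
    c.ι.app j (D.map (homOfLE h) a) = c.ι.app i a := by
  rw [← ConcreteCategory.comp_apply, c.w]

theorem cocone_le (s : Cocone D) {n : ℕ} {a b : D.obj n} {m : ℕ} (h : n ≤ m)
    (hab : D.map (homOfLE h) a ≤ D.map (homOfLE h) b) : s.ι.app n a ≤ s.ι.app n b := by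
  rw [← cocone_apply s h a, ← cocone_apply s h b]
  exact (s.ι.app m).hom.monotone hab

theorem IsChainColimit.le_of_le {c : Cocone D} (hc : IsChainColimit c) (s : Cocone D)
    {n m : ℕ} (a : D.obj n) (b : D.obj m) (h : c.ι.app n a ≤ c.ι.app m b) :
    s.ι.app n a ≤ s.ι.app m b := by
  have hn : n ≤ max n m := le_max_left _ _
  have hm : m ≤ max n m := le_max_right _ _
  rw [← cocone_apply c hn a, ← cocone_apply c hm b] at h
  rw [← cocone_apply s hn a, ← cocone_apply s hm b]
  obtain ⟨k, hk, hab⟩ := hc.refl _ _ _ h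
  exact cocone_le s hk hab

noncomputable def IsChainColimit.isColimit {c : Cocone D} (hc : IsChainColimit c) :
    IsColimit c where
  desc s := PartOrd.ofHom
    { toFun := fun y => s.ι.app (hc.surj y).choose (hc.surj y).choose_spec.choose
      monotone' := fun y y' h => hc.le_of_le s _ _ (by
        rw [(hc.surj y).choose_spec.choose_spec, (hc.surj y').choose_spec.choose_spec]
        exact h) }
  fac s n := by
    ext a
    apply le_antisymm
    · exact hc.le_of_le s _ _ (by
        rw [(hc.surj (c.ι.app n a)).choose_spec.choose_spec])
    · exact hc.le_of_le s _ _ (by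
        rw [(hc.surj (c.ι.app n a)).choose_spec.choose_spec])
  uniq s f hf := by
    ext y
    have h := (hc.surj y).choose_spec.choose_spec
    conv_lhs => rw [← h]
    rw [← ConcreteCategory.comp_apply, hf]
    rfl

/-- An element of some poset of a chain. -/
structure ChainElt (D : ℕ ⥤ PartOrd.{u}) : Type u where
  idx : ℕ
  val : D.obj idx

instance instPreorderChainElt (D : ℕ ⥤ PartOrd.{u}) : Preorder (ChainElt D) where
  le p q := ∃ (k : ℕ) (hp : p.idx ≤ k) (hq : q.idx ≤ k),
    D.map (homOfLE hp) p.val ≤ D.map (homOfLE hq) q.val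
  le_refl p := ⟨p.idx, le_rfl, le_rfl, le_rfl⟩
  le_trans p q r := by
    rintro ⟨k, hp, hq, h⟩ ⟨k', hq', hr, h'⟩
    refine ⟨max k k', hp.trans (le_max_left _ _), hr.trans (le_max_right _ _), ?_⟩
    have e1 := (D.map (homOfLE (le_max_left k k'))).hom.monotone h
    have e2 := (D.map (homOfLE (le_max_right k k'))).hom.monotone h'
    simp only [map_map_apply] at e1 e2
    exact e1.trans e2

def chainColimitMap (D : ℕ ⥤ PartOrd.{u}) (n : ℕ) :
    D.obj n →o Antisymmetrization (ChainElt D) (· ≤ ·) where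
  toFun a := toAntisymmetrization (· ≤ ·) (⟨n, a⟩ : ChainElt D)
  monotone' _ _ h := toAntisymmetrization_le_toAntisymmetrization_iff.2
    ⟨n, le_rfl, le_rfl, (D.map _).hom.monotone h⟩

/-- The colimit of a chain of posets. -/
def chainCocone (D : ℕ ⥤ PartOrd.{u}) : Cocone D where
  pt := PartOrd.of (Antisymmetrization (ChainElt D) (· ≤ ·))
  ι :=
    { app := fun n => PartOrd.ofHom (chainColimitMap D n)
      naturality := fun i j f => by
        ext a
        have hf : f = homOfLE (leOfHom f) := rfl
        apply le_antisymm
        · exact toAntisymmetrization_le_toAntisymmetrization_iff.2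
            ⟨j, le_rfl, leOfHom f, by
              rw [hf]; exact (map_map_apply (leOfHom f) le_rfl a).le⟩
        · exact toAntisymmetrization_le_toAntisymmetrization_iff.2
            ⟨j, leOfHom f, le_rfl, by
              rw [hf]; exact (map_map_apply (leOfHom f) le_rfl a).ge⟩ }

theorem chainCocone_isChainColimit (D : ℕ ⥤ PartOrd.{u}) :
    IsChainColimit (chainCocone D) where
  surj y := by
    change Antisymmetrization (ChainElt D) (· ≤ ·) at y
    induction y using Quotient.inductionOn' with
    | h p => exact ⟨p.idx, p.val, rfl⟩
  refl n a b h := by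
    change toAntisymmetrization (· ≤ ·) (⟨n, a⟩ : ChainElt D) ≤
      toAntisymmetrization (· ≤ ·) (⟨n, b⟩ : ChainElt D) at h
    obtain ⟨k, h1, _, h3⟩ := toAntisymmetrization_le_toAntisymmetrization_iff.1 h
    exact ⟨k, h1, h3⟩

theorem isChainColimit_of_isColimit {c : Cocone D} (hc : IsColimit c) : IsChainColimit c := by
  have h0 := chainCocone_isChainColimit D
  let e := h0.isColimit.coconePointUniqueUpToIso hc
  refine ⟨fun y => ?_, fun n a b h => ?_⟩
  · obtain ⟨n, a, ha⟩ := h0.surj (e.inv y)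
    refine ⟨n, a, ?_⟩
    have : c.ι.app n a = e.hom ((chainCocone D).ι.app n a) := by
      rw [← ConcreteCategory.comp_apply]
      exact congrArg (fun f : D.obj n ⟶ c.pt => f a)
        (h0.isColimit.comp_coconePointUniqueUpToIso_hom hc n).symm
    rw [this, ha]; exact PartOrd.hom_inv_apply e y
  · apply h0.refl
    have key : ∀ a, (chainCocone D).ι.app n a = e.inv (c.ι.app n a) := fun a => by
      rw [← ConcreteCategory.comp_apply]
      exact congrArg (fun f : D.obj n ⟶ (chainCocone D).pt => f a)
        (h0.isColimit.comp_coconePointUniqueUpToIso_inv hc n).symm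
    rw [key, key]; exact e.inv.hom.monotone h

end chain

def ChainCont (F : PartOrd.{u} ⥤ PartOrd.{u}) : Prop :=
  ∀ (D : ℕ ⥤ PartOrd.{u}) (c : Cocone D), IsChainColimit c → IsChainColimit (F.mapCocone c)

theorem ChainCont.comp {F G : PartOrd.{u} ⥤ PartOrd.{u}} (hF : ChainCont F) (hG : ChainCont G) :
    ChainCont (F ⋙ G) := fun D c hc => by
  have := hG _ _ (hF D c hc)
  exact ⟨this.surj, this.refl⟩

theorem chainCont_dual : ChainCont PartOrd.dual.{u} := fun D c hc =>
  ⟨fun y => hc.surj y, fun n a b h => by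
    obtain ⟨m, hm, h'⟩ := hc.refl n b a h
    exact ⟨m, hm, h'⟩⟩

theorem chainCont_of_preserves (T : PartOrd.{u} ⥤ PartOrd.{u}) [PreservesFilteredColimits T] :
    ChainCont T := fun D c hc => by
  have : PreservesFilteredColimitsOfSize.{0, 0} T :=
    preservesFilteredColimitsOfSize_shrink.{0, u, 0, u} T
  exact isChainColimit_of_isColimit (isColimitOfPreserves T hc.isColimit)

/-! Adamek -/
section adamek
variable (F : PartOrd.{u} ⥤ PartOrd.{u})

def stage : ℕ → PartOrd.{u}
  | 0 => PartOrd.of PEmpty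
  | n + 1 => F.obj (stage n)

def fromEmpty (X : PartOrd.{u}) : PartOrd.of PEmpty.{u+1} ⟶ X :=
  PartOrd.ofHom { toFun := fun a => a.elim, monotone' := fun a => a.elim }

def stageMap : ∀ n, stage F n ⟶ stage F (n + 1)
  | 0 => fromEmpty _
  | n + 1 => F.map (stageMap n)

def stageChain : ℕ ⥤ PartOrd.{u} := Functor.ofSequence (stageMap F)

theorem stageChain_map (n : ℕ) :
    (stageChain F).map (homOfLE (Nat.le_add_right n 1)) = stageMap F n :=
  Functor.ofSequence_map_homOfLE_succ _ _

/-- A cocone over the chain is a compatible sequence of maps. -/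
def stageCocone {X : PartOrd.{u}} (f : ∀ n, stage F n ⟶ X)
    (hf : ∀ n, stageMap F n ≫ f (n + 1) = f n) : Cocone (stageChain F) where
  pt := X
  ι := NatTrans.ofSequence (G := (Functor.const ℕ).obj X) f (fun n => by
    rw [stageChain_map]; exact (hf n).trans (Category.comp_id _).symm)

def stageCocone' {X : PartOrd.{u}} (f : ∀ n, F.obj (stage F n) ⟶ X)
    (hf : ∀ n, F.map (stageMap F n) ≫ f (n + 1) = f n) : Cocone (stageChain F ⋙ F) where
  pt := X
  ι := NatTrans.ofSequence (F := stageChain F ⋙ F) (G := (Functor.const ℕ).obj X) f (fun n => by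
    rw [Functor.comp_map, stageChain_map]; exact (hf n).trans (Category.comp_id _).symm)

theorem chainCocone_w (n : ℕ) :
    stageMap F n ≫ (chainCocone (stageChain F)).ι.app (n + 1) =
      (chainCocone (stageChain F)).ι.app n := by
  rw [← stageChain_map]; exact Cocone.w _ _

def stageTo (A : Endofunctor.Algebra F) : ∀ n, stage F n ⟶ A.a
  | 0 => fromEmpty _
  | n + 1 => F.map (stageTo A n) ≫ A.str

theorem stageTo_w (A : Endofunctor.Algebra F) :
    ∀ n, stageMap F n ≫ stageTo F A (n + 1) = stageTo F A n
  | 0 => by ext a; exact PEmpty.elim a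
  | n + 1 => by
    have := stageTo_w A n
    change F.map (stageMap F n) ≫ F.map (stageTo F A (n+1)) ≫ A.str = F.map (stageTo F A n) ≫ A.str
    rw [← Category.assoc, ← F.map_comp, this]

theorem exists_initialAlgebra (hF : ChainCont F) :
    ∃ A : Endofunctor.Algebra F, Nonempty (IsInitial A) := by
  let c := chainCocone (stageChain F)
  have hc : IsColimit c := (chainCocone_isChainColimit (stageChain F)).isColimit
  have hFc : IsColimit (F.mapCocone c) :=
    (hF _ _ (chainCocone_isChainColimit (stageChain F))).isColimit
  let str : F.obj c.pt ⟶ c.pt :=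
    hFc.desc (stageCocone' F (fun n => c.ι.app (n + 1)) (fun n => chainCocone_w F (n + 1)))
  have hstr : ∀ n, F.map (c.ι.app n) ≫ str = c.ι.app (n + 1) := fun n => hFc.fac _ n
  refine ⟨⟨c.pt, str⟩, ⟨IsInitial.ofUniqueHom (fun A => ⟨hc.desc
    (stageCocone F (stageTo F A) (stageTo_w F A)), ?_⟩) ?_⟩⟩
  · have hd : ∀ n, c.ι.app n ≫ hc.desc (stageCocone F (stageTo F A) (stageTo_w F A)) =
      stageTo F A n := fun n => hc.fac _ n
    apply hFc.hom_ext
    intro n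
    change F.map (c.ι.app n) ≫ _ = F.map (c.ι.app n) ≫ _
    refine ((Category.assoc _ _ _).symm.trans ?_).trans (Category.assoc _ _ _)
    rw [hstr]
    refine Eq.trans ?_ (hd (n + 1)).symm
    exact congrArg (· ≫ A.str) ((F.map_comp _ _).symm.trans (congrArg F.map (hd n)))
  · intro A g
    ext1
    apply hc.hom_ext
    intro n
    refine Eq.trans ?_ (hc.fac (stageCocone F (stageTo F A) (stageTo_w F A)) n).symm
    change c.ι.app n ≫ g.f = stageTo F A n
    induction n with
    | zero => ext a; exact PEmpty.elim a
    | succ n ih =>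
      have := g.h
      change F.map g.f ≫ A.str = str ≫ g.f at this
      rw [← hstr n]
      refine (Category.assoc _ _ _).trans ?_
      rw [← this]
      refine (Category.assoc _ _ _).symm.trans ?_
      exact congrArg (· ≫ A.str) ((F.map_comp _ _).symm.trans (congrArg F.map ih))
end adamek
theorem IsChainColimit.exists_finite_lift {D : ℕ ⥤ PartOrd.{u}} {c : Cocone D}
    (hc : IsChainColimit c) {s : Set c.pt} (hs : s.Finite) :
    ∃ (n : ℕ) (t : Set (D.obj n)), t.Finite ∧ c.ι.app n '' t = s := by
  induction s, hs using Set.Finite.induction_on with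
  | empty => exact ⟨0, ∅, Set.finite_empty, Set.image_empty _⟩
  | @insert y s _ _ ih =>
    obtain ⟨n, t, ht, hts⟩ := ih
    obtain ⟨m, a, ha⟩ := hc.surj y
    refine ⟨max n m, insert (D.map (homOfLE (le_max_right n m)) a)
      (D.map (homOfLE (le_max_left n m)) '' t), (ht.image _).insert _, ?_⟩
    rw [Set.image_insert_eq, Set.image_image, cocone_apply, ha, ← hts]
    congr 1
    exact Set.image_congr fun b _ => cocone_apply c (le_max_left n m) b

theorem IsChainColimit.exists_stage {D : ℕ ⥤ PartOrd.{u}} {c : Cocone D}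
    (hc : IsChainColimit c) {n : ℕ} {t : Set (D.obj n)} (ht : t.Finite)
    (P : D.obj n → D.obj n → Prop) (h : ∀ b ∈ t, ∃ a, P a b ∧ c.ι.app n a ≤ c.ι.app n b) :
    ∃ (m : ℕ) (hm : n ≤ m), ∀ b ∈ t, ∃ a, P a b ∧
      D.map (homOfLE hm) a ≤ D.map (homOfLE hm) b := by
  induction t, ht using Set.Finite.induction_on with
  | empty => exact ⟨n, le_rfl, fun b hb => absurd hb (Set.notMem_empty b)⟩
  | @insert y s _ _ ih =>
    obtain ⟨m, hm, h1⟩ := ih fun b hb => h b (Set.mem_insert_of_mem _ hb)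
    obtain ⟨a, ha, hay⟩ := h y (Set.mem_insert _ _)
    obtain ⟨k, hk, hay'⟩ := hc.refl n a y hay
    refine ⟨max m k, hm.trans (le_max_left _ _), ?_⟩
    rintro b (rfl | hb)
    · refine ⟨a, ha, ?_⟩
      have := (D.map (homOfLE (le_max_right m k))).hom.monotone hay'
      simpa only [map_map_apply] using this
    · obtain ⟨a', ha', hab⟩ := h1 b hb
      refine ⟨a', ha', ?_⟩
      have := (D.map (homOfLE (le_max_left m k))).hom.monotone hab
      simpa only [map_map_apply] using this

theorem chainCont_up : ChainCont upFunctor.{u} := fun D c hc => by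
  refine ⟨fun y => ?_, fun n φ φ' h => ?_⟩
  · obtain ⟨s, hs, hy⟩ := y.2
    obtain ⟨n, t, ht, rfl⟩ := hc.exists_finite_lift hs
    refine ⟨n, ⟨upperClosure t, t, ht, rfl⟩, Subtype.ext ?_⟩
    exact (upperClosure_image (c.ι.app n).hom t).trans hy.symm
  · obtain ⟨t, ht, hφ'⟩ := φ'.2
    have hsub : ∀ b ∈ t, ∃ a, a ∈ φ.1 ∧ c.ι.app n a ≤ c.ι.app n b := fun b hb => by
      have hb' : c.ι.app n b ∈ upperClosure ((c.ι.app n).hom '' (φ'.1 : Set (D.obj n))) :=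
        subset_upperClosure ⟨b, by rw [hφ']; exact subset_upperClosure hb, rfl⟩
      obtain ⟨_, ⟨a, ha, rfl⟩, hab⟩ := mem_upperClosure.1 (h hb')
      exact ⟨a, ha, hab⟩
    obtain ⟨m, hm, h1⟩ := hc.exists_stage ht (fun a _ => a ∈ φ.1) hsub
    refine ⟨m, hm, ?_⟩
    change upperClosure ((D.map (homOfLE hm)).hom '' (φ.1 : Set (D.obj n))) ≤
      upperClosure ((D.map (homOfLE hm)).hom '' (φ'.1 : Set (D.obj n)))
    rw [hφ', upperClosure_image]
    refine le_upperClosure.2 ?_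
    rintro _ ⟨b, hb, rfl⟩
    obtain ⟨a, ha, hab⟩ := h1 b hb
    exact mem_upperClosure.2 ⟨_, ⟨a, ha, rfl⟩, hab⟩

theorem chainCont_low : ChainCont lowFunctor.{u} := fun D c hc => by
  have hd := chainCont_dual D c hc
  refine ⟨fun y => ?_, fun n φ' φ h => ?_⟩
  · obtain ⟨s, hs, hy⟩ := y.2
    obtain ⟨n, t, ht, rfl⟩ := hc.exists_finite_lift hs
    refine ⟨n, ⟨lowerClosure t, t, ht, rfl⟩, Subtype.ext ?_⟩
    exact (lowerClosure_image (c.ι.app n).hom t).trans hy.symm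
  · obtain ⟨t, ht, hφ'⟩ := φ'.2
    have hsub : ∀ b ∈ t, ∃ a, a ∈ φ.1 ∧ c.ι.app n b ≤ c.ι.app n a := fun b hb => by
      have hb' : c.ι.app n b ∈ lowerClosure ((c.ι.app n).hom '' (φ'.1 : Set (D.obj n))) :=
        subset_lowerClosure ⟨b, by rw [hφ']; exact subset_lowerClosure hb, rfl⟩
      obtain ⟨_, ⟨a, ha, rfl⟩, hab⟩ := mem_lowerClosure.1 (h hb')
      exact ⟨a, ha, hab⟩
    obtain ⟨m, hm, h1⟩ := hd.exists_stage (n := n) (t := t) ht (fun a _ => a ∈ φ.1) hsub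
    refine ⟨m, hm, ?_⟩
    change lowerClosure ((D.map (homOfLE hm)).hom '' (φ'.1 : Set (D.obj n))) ≤
      lowerClosure ((D.map (homOfLE hm)).hom '' (φ.1 : Set (D.obj n)))
    rw [hφ', lowerClosure_image]
    refine lowerClosure_le.2 ?_
    rintro _ ⟨b, hb, rfl⟩
    obtain ⟨a, ha, hab⟩ := h1 b hb
    exact mem_lowerClosure.2 ⟨_, ⟨a, ha, rfl⟩, hab⟩

theorem chainCont_const (X : PartOrd.{u}) : ChainCont ((Functor.const PartOrd.{u}).obj X) :=
  fun _ _ _ => ⟨fun y => ⟨0, y, rfl⟩, fun n _ _ h => ⟨n, le_rfl, h⟩⟩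

theorem ChainCont.sum {F G : PartOrd.{u} ⥤ PartOrd.{u}} (hF : ChainCont F) (hG : ChainCont G) :
    ChainCont (sumFunctor F G) := fun D c hc => by
  refine ⟨?_, fun n => ?_⟩
  · rintro (y | y)
    · obtain ⟨n, a, ha⟩ := (hF D c hc).surj y
      exact ⟨n, Sum.inl a, congrArg Sum.inl ha⟩
    · obtain ⟨n, a, ha⟩ := (hG D c hc).surj y
      exact ⟨n, Sum.inr a, congrArg Sum.inr ha⟩
  · rintro (a | a) (b | b) h
    · obtain ⟨m, hm, h'⟩ := (hF D c hc).refl n a b (Sum.inl_le_inl_iff.1 h)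
      exact ⟨m, hm, Sum.inl_le_inl_iff.2 h'⟩
    · exact absurd h Sum.not_inl_le_inr
    · exact absurd h Sum.not_inr_le_inl
    · obtain ⟨m, hm, h'⟩ := (hG D c hc).refl n a b (Sum.inr_le_inr_iff.1 h)
      exact ⟨m, hm, Sum.inr_le_inr_iff.2 h'⟩

/-! ## The language -/

section Language

variable (T : PartOrd.{u} ⥤ PartOrd.{u}) [hT : IsMossFunctor T] (At : PartOrd.{u})

theorem exists_language : ∃ A : Algebra (langFunctor T At), Nonempty (IsInitial A) := by
  have := hT.finitary
  have h : ChainCont (dualFunctor T) :=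
    chainCont_dual.comp ((chainCont_of_preserves T).comp chainCont_dual)
  exact exists_initialAlgebra _
    ((chainCont_const At).sum (chainCont_up.sum (chainCont_low.sum (h.sum h))))

/-- The algebra of formulas: the initial algebra for `At + 𝕌_ω + 𝕃_ω + T^∂ + T^∂`, that is, the
algebra for `𝕌_ω + 𝕃_ω + T^∂ + T^∂` free on `At`. -/
noncomputable def langAlg : Algebra (langFunctor T At) := (exists_language T At).choose

noncomputable def langAlgInitial : IsInitial (langAlg T At) :=
  (exists_language T At).choose_spec.some

/-- The poset of formulas. -/
noncomputable abbrev Lang : PartOrd.{u} := (langAlg T At).a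

/-- Atoms as formulas. -/
noncomputable def atom : At ⟶ Lang T At :=
  sumInl ((Functor.const PartOrd).obj At) _ (Lang T At) ≫ (langAlg T At).str

/-- The conjunction map `⋀ : 𝕌_ω 𝓛 → 𝓛`. -/
noncomputable def conj : upFunctor.obj (Lang T At) ⟶ Lang T At :=
  sumInl upFunctor _ (Lang T At) ≫ sumInr _ _ (Lang T At) ≫ (langAlg T At).str

/-- The disjunction map `⋁ : 𝕃_ω 𝓛 → 𝓛`. -/
noncomputable def disj : lowFunctor.obj (Lang T At) ⟶ Lang T At :=
  sumInl lowFunctor _ (Lang T At) ≫ sumInr _ _ (Lang T At) ≫ sumInr _ _ (Lang T At) ≫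
    (langAlg T At).str

/-- The modality `∇ : T^∂ 𝓛 → 𝓛`. -/
noncomputable def nabla : (dualFunctor T).obj (Lang T At) ⟶ Lang T At :=
  sumInl (dualFunctor T) (dualFunctor T) (Lang T At) ≫ sumInr _ _ (Lang T At) ≫
    sumInr _ _ (Lang T At) ≫ sumInr _ _ (Lang T At) ≫ (langAlg T At).str

/-- The modality `Δ : T^∂ 𝓛 → 𝓛`. -/
noncomputable def delta : (dualFunctor T).obj (Lang T At) ⟶ Lang T At :=
  sumInr (dualFunctor T) (dualFunctor T) (Lang T At) ≫ sumInr _ _ (Lang T At) ≫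
    sumInr _ _ (Lang T At) ≫ sumInr _ _ (Lang T At) ≫ (langAlg T At).str

end Language

/-! ## Semantics -/

section Semantics

variable {T : PartOrd.{u} ⥤ PartOrd.{u}} {At : PartOrd.{u}}

/-- Truth sets in `X`, ordered by inclusion: monotone maps from `A` into this poset are the same
as monotone relations from `A` to `X^op`. -/
abbrev truthSets (X : PartOrd.{u}) : PartOrd.{u} := PartOrd.of (LowerSet (opPos X))

/-- The relation `x ∈ S` between states and truth sets. -/
def memTruth (X : PartOrd.{u}) : MonRel (truthSets X) (opPos X) where
  rel x S := x ∈ S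
  mono {_ _ S _} h hx hS := hS (S.lower hx h)

/-- The relation `c(x) \bar{T^∂}R α` for `R : A ⇸ X^op`, where `c(x)` is regarded as an element of
`T^∂(X^op) = (T X)^op`. -/
def nablaRel (c : Coalgebra T) {A : PartOrd.{u}} (R : MonRel A (opPos c.V)) :
    MonRel ((dualFunctor T).obj A) (opPos c.V) where
  rel x α := (R.lift (dualFunctor T)).rel (PartOrd.dual.map c.str x) α
  mono h hx hα := (R.lift (dualFunctor T)).mono h ((PartOrd.dual.map c.str).hom.monotone hx) hα

/-- The negation of a relation `R : A ⇸ X^op` as a relation `A^op ⇸ X`. -/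
def negRel {A X : PartOrd.{u}} (R : MonRel A (opPos X)) :
    MonRel (opPos A) X where
  rel x a := ¬ R.rel (toOp x) (ofOp a)
  mono h hx ha h' := h (R.mono h' hx ha)

/-- The negation of the relation `c(x) \bar{T}(¬R) β` for `R : A ⇸ X^op`. -/
def deltaRel (c : Coalgebra T) {A : PartOrd.{u}} (R : MonRel A (opPos c.V)) :
    MonRel ((dualFunctor T).obj A) (opPos c.V) where
  rel x β := ¬ ((negRel R).lift T).rel (c.str (ofOp x)) (OrderDual.ofDual β)
  mono h hx hβ h' := h (((negRel R).lift T).mono h' (c.str.hom.monotone hx) hβ)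

/-- The truth set map of a relation. -/
def MonRel.toTruth {A X : PartOrd.{u}} (R : MonRel A (opPos X)) : A ⟶ truthSets X :=
  PartOrd.ofHom
    { toFun := fun a => ⟨{x | R.rel x a}, fun _ _ hx h => R.mono h hx le_rfl⟩
      monotone' := fun _ _ ha _ h => R.mono h le_rfl ha }

/-- Intersection of a finitely generated upper set of truth sets. -/
def interTruth (X : PartOrd.{u}) : upFunctor.obj (truthSets X) ⟶ truthSets X :=
  PartOrd.ofHom
    { toFun := fun φ => sInf {S : LowerSet (opPos X) | S ∈ φ.1}
      monotone' := fun _ _ h => sInf_le_sInf h }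

/-- Union of a finitely generated lower set of truth sets. -/
def unionTruth (X : PartOrd.{u}) : lowFunctor.obj (truthSets X) ⟶ truthSets X :=
  PartOrd.ofHom
    { toFun := fun ψ => sSup {S : LowerSet (opPos X) | S ∈ ψ.1}
      monotone' := fun _ _ h => sSup_le_sSup h }

/-- The semantics of the connectives on truth sets. -/
def semAlg (c : Coalgebra T) (v : MonRel At (opPos c.V)) :
    Algebra (langFunctor T At) where
  a := truthSets c.V
  str := sumDesc v.toTruth (sumDesc (interTruth c.V) (sumDesc (unionTruth c.V)
    (sumDesc (nablaRel c (memTruth c.V)).toTruth (deltaRel c (memTruth c.V)).toTruth)))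

variable [hT : IsMossFunctor T]

/-- The semantics relation `⊩ : 𝓛 ⇸ X^op` of a coalgebra with a valuation of the atoms, defined
by recursion on formulas. The recursion clauses are `satRel_atom`, …, `satRel_delta`. -/
noncomputable def satRel (c : Coalgebra T) (v : MonRel At (opPos c.V)) :
    MonRel (Lang T At) (opPos c.V) :=
  (memTruth c.V).restrict ((langAlgInitial T At).to (semAlg c v)).f

theorem satRel_str (c : Coalgebra T) (v : MonRel At (opPos c.V))
    (x : opPos c.V) (a : (langFunctor T At).obj (Lang T At)) :
    (satRel c v).rel x ((langAlg T At).str a) ↔ (memTruth c.V).rel x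
      ((semAlg c v).str ((langFunctor T At).map ((langAlgInitial T At).to (semAlg c v)).f a)) := by
  have h : ((langAlgInitial T At).to (semAlg c v)).f ((langAlg T At).str a) =
      (semAlg c v).str ((langFunctor T At).map ((langAlgInitial T At).to (semAlg c v)).f a) := by
    rw [← ConcreteCategory.comp_apply, ← ((langAlgInitial T At).to (semAlg c v)).h]
    rfl
  rw [← h]
  rfl

theorem satRel_atom (c : Coalgebra T) (v : MonRel At (opPos c.V))
    (x : opPos c.V) (p : At) : (satRel c v).rel x (atom T At p) ↔ v.rel x p :=
  satRel_str c v x _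

theorem satRel_conj (c : Coalgebra T) (v : MonRel At (opPos c.V))
    (x : opPos c.V) (φ : upFunctor.obj (Lang T At)) :
    (satRel c v).rel x (conj T At φ) ↔ ∀ a ∈ φ.1, (satRel c v).rel x a := by
  refine (satRel_str c v x _).trans ?_
  change x ∈ sInf {S : LowerSet (opPos c.V) |
    S ∈ upperClosure (((langAlgInitial T At).to (semAlg c v)).f.hom '' (φ.1 : Set (Lang T At)))} ↔ _
  rw [LowerSet.mem_sInf_iff]
  constructor
  · intro h a ha
    exact h _ (subset_upperClosure ⟨a, ha, rfl⟩)
  · rintro h S ⟨_, ⟨a, ha, rfl⟩, hS⟩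
    exact hS (h a ha)

theorem satRel_disj (c : Coalgebra T) (v : MonRel At (opPos c.V))
    (x : opPos c.V) (ψ : lowFunctor.obj (Lang T At)) :
    (satRel c v).rel x (disj T At ψ) ↔ ∃ a ∈ ψ.1, (satRel c v).rel x a := by
  refine (satRel_str c v x _).trans ?_
  change x ∈ sSup {S : LowerSet (opPos c.V) |
    S ∈ lowerClosure (((langAlgInitial T At).to (semAlg c v)).f.hom '' (ψ.1 : Set (Lang T At)))} ↔ _
  rw [LowerSet.mem_sSup_iff]
  constructor
  · rintro ⟨S, ⟨_, ⟨a, ha, rfl⟩, hS⟩, hx⟩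
    exact ⟨a, ha, hS hx⟩
  · rintro ⟨a, ha, h⟩
    exact ⟨_, subset_lowerClosure ⟨a, ha, rfl⟩, h⟩

/-- `x ⊩ ∇α` iff `c(x) \bar{T^∂}⊩ α`. -/
theorem satRel_nabla (c : Coalgebra T) (v : MonRel At (opPos c.V))
    (x : opPos c.V) (α : (dualFunctor T).obj (Lang T At)) :
    (satRel c v).rel x (nabla T At α) ↔ (nablaRel c (satRel c v)).rel x α := by
  refine (satRel_str c v x _).trans ?_
  exact MonRel.lift_restrict (IsMossFunctor.exact_dual T) _ _ _ _

/-- `x ⊮ Δβ` iff `c(x) \bar{T}⊮ β`. -/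
theorem satRel_delta (c : Coalgebra T) (v : MonRel At (opPos c.V))
    (x : opPos c.V) (β : (dualFunctor T).obj (Lang T At)) :
    (satRel c v).rel x (delta T At β) ↔ (deltaRel c (satRel c v)).rel x β := by
  refine (satRel_str c v x _).trans ?_
  exact not_congr (MonRel.lift_restrict hT.exact (negRel (memTruth c.V))
    (PartOrd.dual.map ((langAlgInitial T At).to (semAlg c v)).f) _ _)

end Semantics

/-! ## Sequents and redistributions -/

section Sequents

variable (T : PartOrd.{u} ⥤ PartOrd.{u}) [IsMossFunctor T] (At : PartOrd.{u})

/-- A sequent `φ ⇒ ψ`. -/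
structure Sequent where
  lhs : upFunctor.obj (Lang T At)
  rhs : lowFunctor.obj (Lang T At)

variable {T At}

/-- The sequent is refuted in the state `x`: `x ⊩ ⋀φ` and `x ⊮ ⋁ψ`. -/
def Sequent.RefutedAt (S : Sequent T At) (c : Coalgebra T)
    (v : MonRel At (opPos c.V)) (x : c.V) : Prop :=
  (satRel c v).rel (toOp x) (conj T At S.lhs) ∧
    ¬ (satRel c v).rel (toOp x) (disj T At S.rhs)

/-- Some state of some coalgebra refutes the sequent under some monotone valuation. -/
def Sequent.Refutable (S : Sequent T At) : Prop :=
  ∃ (c : Coalgebra T) (v : MonRel At (opPos c.V)) (x : c.V), S.RefutedAt c v x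

/-- The sequent `π, {∇α | α ∈ A} ⇒ {Δβ | β ∈ B}, λ`. -/
noncomputable def reducedSequent (π : upFunctor.obj (Lang T At)) (l : lowFunctor.obj (Lang T At))
    (A : upFunctor.obj ((dualFunctor T).obj (Lang T At)))
    (B : lowFunctor.obj ((dualFunctor T).obj (Lang T At))) : Sequent T At where
  lhs := UpFin.union π (upFunctor.map (nabla T At) A)
  rhs := LowFin.union (lowFunctor.map (delta T At) B) l

/-- The base `V` of `A`, with `A ∈ 𝕌_ω T^∂ V`. -/
def baseUp (A : upFunctor.obj ((dualFunctor T).obj (Lang T At))) : Set (Lang T At) :=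
  base (dualFunctor T ⋙ upFunctor) A

/-- The base `W` of `B`, with `B ∈ 𝕃_ω T^∂ W`. -/
def baseLow (B : lowFunctor.obj ((dualFunctor T).obj (Lang T At))) : Set (Lang T At) :=
  base (dualFunctor T ⋙ lowFunctor) B

/-- Redistributions of `(A, B)`: elements `Φ` of `T^∂(𝕌_ω base(A) × 𝕃_ω base(B))`, regarded as
elements of `T^∂(𝕌_ω 𝓛 × 𝕃_ω 𝓛)`, such that `(T^∂ p₀)Φ \bar{T^∂}∋ α` for all `α ∈ A` and
`β \bar{T^∂}∈ (T^∂ p₁)Φ` for all `β ∈ B`. -/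
structure IsRedistribution (A : upFunctor.obj ((dualFunctor T).obj (Lang T At)))
    (B : lowFunctor.obj ((dualFunctor T).obj (Lang T At)))
    (Φ : (dualFunctor T).obj
      (prodPos (upFunctor.obj (Lang T At)) (lowFunctor.obj (Lang T At)))) : Prop where
  mem : ∃ w : (dualFunctor T).obj
      (prodPos (upFunctor.obj (subPos (baseUp A))) (lowFunctor.obj (subPos (baseLow B)))),
    (dualFunctor T).map (prodPosMap (upFunctor.map (incl (baseUp A)))
      (lowFunctor.map (incl (baseLow B)))) w = Φ
  left : ∀ α ∈ A.1, ((memUp (Lang T At)).lift (dualFunctor T)).rel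
    ((dualFunctor T).map (prodFst _ _) Φ) α
  right : ∀ β ∈ B.1, ((memLow (Lang T At)).lift (dualFunctor T)).rel
    β ((dualFunctor T).map (prodSnd _ _) Φ)

end Sequents

end MossLogic

open MossLogic

namespace MossLogic

/-! Write `x ⊩ a` for truth. By monotonicity of truth, a state `x` refutes the reduced sequent iff
it refutes `π ⇒ λ`, the structure `c(x)` is related to each `α ∈ A` by the lifting of `⊩`, and each
`β ∈ B` is related to `c(x)` by the lifting of `⊮` (`reducedSequent_refutedAt_iff`). Everything then
rests on moving lifted relations along monotone maps: forwards for any functor (`MonRel.lift_map`),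
backwards when the functor preserves exact squares (`MonRel.lift_comap`).

From a refuting state `x`, send each state `y` to its theory: the formulas of `V` true at `y` and
the formulas of `W` false at `y`. This is a monotone map (`theoryMap`), with finitely generated
values because bases are finite (`base_dual_spec`, `base_up_spec`, `base_low_spec`). The image of
`c(x)` under `T^∂` of this map is the redistribution; its base consists of theories of states, and
each such state refutes the corresponding sequent (`exists_redistribution`).

Conversely, choose a refuting pointed model for each `z` in the base of `Φ` and take the disjoint
union. The choice need not be monotone in `z`, so `Φ` is first lifted to the discrete poset on its
base, which is possible because `T^∂` preserves surjections (`exists_discrete_lift`). The lifted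
element, transported along the chosen points, becomes the successor structure of one new state,
whose atoms are copied from a state refuting `π ⇒ λ` (`reducedSequent_refutable`). Truth in the
components is unaffected by this gluing, because inverse image along a coalgebra morphism is an
algebra morphism and formulas form an initial algebra (`satRel_hom`). -/

/-- The functor preserves exact squares. -/
def PreservesExact (F : PartOrd.{u} ⥤ PartOrd.{u}) : Prop :=
  ∀ ⦃P A B C : PartOrd.{u}⦄ (p₀ : P ⟶ A) (p₁ : P ⟶ B) (f : A ⟶ C) (g : B ⟶ C),
    ExactSquare p₀ p₁ f g → ExactSquare (F.map p₀) (F.map p₁) (F.map f) (F.map g)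

theorem preservesExact_dual (T : PartOrd.{u} ⥤ PartOrd.{u}) [IsMossFunctor T] :
    PreservesExact (dualFunctor T) :=
  fun _ _ _ _ => IsMossFunctor.exact_dual T

theorem map_comp_apply (F : PartOrd.{u} ⥤ PartOrd.{u}) {X Y Z : PartOrd.{u}} (f : X ⟶ Y)
    (g : Y ⟶ Z) (a : F.obj X) : F.map (f ≫ g) a = F.map g (F.map f a) := by
  rw [← ConcreteCategory.comp_apply, ← F.map_comp]

theorem map_id_apply (F : PartOrd.{u} ⥤ PartOrd.{u}) {X : PartOrd.{u}} (a : F.obj X) :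
    F.map (𝟙 X) a = a := by
  rw [F.map_id]; rfl

/-! ### Relation lifting and surjections for functors preserving exact squares. -/

section exact

variable {F : PartOrd.{u} ⥤ PartOrd.{u}}

/-- A map `f` is surjective exactly when the square with both projections `f` and both other sides
the identity is exact: an element squeezed between `b` and `b` is `b`. -/
theorem PreservesExact.map_surjective (hF : PreservesExact F) {X Y : PartOrd.{u}} (f : X ⟶ Y)
    (hf : Function.Surjective f) : Function.Surjective (F.map f) := fun b => by
  have h : ExactSquare f f (𝟙 Y) (𝟙 Y) := ⟨fun w => le_rfl, fun a b hab => by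
    obtain ⟨w, rfl⟩ := hf a
    exact ⟨w, le_rfl, hab⟩⟩
  obtain ⟨w, h1, h2⟩ := (hF _ _ _ _ h).2 b b le_rfl
  exact ⟨w, le_antisymm h2 h1⟩

/-- The restriction `R(f-, -)`. -/
def MonRel.restrictLeft {B X Y : PartOrd.{u}} (R : MonRel X Y) (f : B ⟶ Y) : MonRel X B where
  rel b x := R.rel (f b) x
  mono h hb hx := R.mono h (f.hom.monotone hb) hx

/-- Relation lifting is functorial in the relation. -/
theorem MonRel.lift_map {X Y X' Y' : PartOrd.{u}} {R : MonRel X Y} {R' : MonRel X' Y'}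
    {f : Y ⟶ Y'} {g : X ⟶ X'} (h : ∀ y x, R.rel y x → R'.rel (f y) (g x))
    {β : F.obj Y} {α : F.obj X} (hβα : (R.lift F).rel β α) :
    (R'.lift F).rel (F.map f β) (F.map g α) := by
  obtain ⟨w, h1, h2⟩ := hβα
  let k : R.graph ⟶ R'.graph := PartOrd.ofHom
    { toFun := fun q => ⟨(f q.1.1, g q.1.2), h _ _ q.2⟩
      monotone' := fun q q' hq => ⟨f.hom.monotone hq.1, g.hom.monotone hq.2⟩ }
  refine ⟨F.map k w, ?_, ?_⟩
  · refine ((F.map f).hom.monotone h1).trans (le_of_eq ?_)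
    exact (map_comp_apply F (incl _ ≫ prodFst Y X) f w).symm.trans
      (map_comp_apply F k (incl _ ≫ prodFst Y' X') w)
  · refine le_trans (le_of_eq ?_) ((F.map g).hom.monotone h2)
    exact (map_comp_apply F k (incl _ ≫ prodSnd Y' X') w).symm.trans
      (map_comp_apply F (incl _ ≫ prodSnd Y X) g w)

theorem MonRel.lift_mono {X Y : PartOrd.{u}} {R R' : MonRel X Y}
    (h : ∀ y x, R.rel y x → R'.rel y x) {β : F.obj Y} {α : F.obj X}
    (hβα : (R.lift F).rel β α) : (R'.lift F).rel β α := by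
  simpa only [map_id_apply] using MonRel.lift_map (f := 𝟙 Y) (g := 𝟙 X) h hβα

theorem MonRel.lift_restrictLeft (hF : PreservesExact F) {B X Y : PartOrd.{u}} (R : MonRel X Y)
    (f : B ⟶ Y) {β : F.obj B} {α : F.obj X} (h : (R.lift F).rel (F.map f β) α) :
    ((R.restrictLeft f).lift F).rel β α := by
  obtain ⟨w, h1, h2⟩ := h
  -- The comma object of `f` and the first projection of the graph; comma squares are always exact.
  let P : PartOrd.{u} := subPos (X := prodPos B R.graph) {q | f q.1 ≤ q.2.1.1}
  let q₀ : P ⟶ B := incl _ ≫ prodFst B R.graph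
  let q₁ : P ⟶ R.graph := incl _ ≫ prodSnd B R.graph
  have hex : ExactSquare q₀ q₁ f (incl _ ≫ prodFst Y X) :=
    ⟨fun q => q.2, fun b e h => ⟨⟨(b, e), h⟩, le_rfl, le_rfl⟩⟩
  obtain ⟨v, hv1, hv2⟩ := (hF _ _ _ _ hex).2 β w h1
  let k : P ⟶ (R.restrictLeft f).graph := PartOrd.ofHom
    { toFun := fun q => ⟨(q.1.1, q.1.2.1.2), R.mono q.1.2.2 q.2 le_rfl⟩
      monotone' := fun q q' h => ⟨h.1, h.2.2⟩ }
  refine ⟨F.map k v, ?_, ?_⟩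
  · rw [← map_comp_apply]
    exact hv1
  · rw [← map_comp_apply]
    refine le_trans (le_of_eq ?_) (((F.map (incl _ ≫ prodSnd Y X)).hom.monotone hv2).trans h2)
    exact map_comp_apply F q₁ (incl _ ≫ prodSnd Y X) v

/-- Lifted relations can be restricted on both sides. -/
theorem MonRel.lift_comap (hF : PreservesExact F) {X Y X' Y' : PartOrd.{u}} {R : MonRel X Y}
    {R' : MonRel X' Y'} {f : Y ⟶ Y'} {g : X ⟶ X'} (h : ∀ y x, R'.rel (f y) (g x) → R.rel y x)
    {β : F.obj Y} {α : F.obj X} (hβα : (R'.lift F).rel (F.map f β) (F.map g α)) :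
    (R.lift F).rel β α :=
  MonRel.lift_mono h ((MonRel.lift_restrict (@hF) (R'.restrictLeft f) g β α).1
    (MonRel.lift_restrictLeft hF R' f hβα))

/-- Transport along a map on one side only, obtained from `lift_map` and `lift_comap` with the
identity on the other side. -/
theorem MonRel.lift_left_iff (hF : PreservesExact F) {X Y Y' : PartOrd.{u}} {R : MonRel X Y}
    {R' : MonRel X Y'} {f : Y ⟶ Y'} (h : ∀ y x, R'.rel (f y) x ↔ R.rel y x) (β : F.obj Y)
    (α : F.obj X) : (R'.lift F).rel (F.map f β) α ↔ (R.lift F).rel β α := by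
  have h1 := MonRel.lift_map (F := F) (R := R) (R' := R') (f := f) (g := 𝟙 X)
    (fun y x => (h y x).2) (β := β) (α := α)
  have h2 := MonRel.lift_comap hF (R := R) (R' := R') (f := f) (g := 𝟙 X)
    (fun y x => (h y x).1) (β := β) (α := α)
  rw [map_id_apply] at h1 h2
  exact ⟨h2, h1⟩

theorem MonRel.lift_right_iff (hF : PreservesExact F) {X X' Y : PartOrd.{u}} {R : MonRel X Y}
    {R' : MonRel X' Y} {g : X ⟶ X'} (h : ∀ y x, R'.rel y (g x) ↔ R.rel y x) (β : F.obj Y)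
    (α : F.obj X) : (R'.lift F).rel β (F.map g α) ↔ (R.lift F).rel β α := by
  have h1 := MonRel.lift_map (F := F) (R := R) (R' := R') (f := 𝟙 Y) (g := g)
    (fun y x => (h y x).2) (β := β) (α := α)
  have h2 := MonRel.lift_comap hF (R := R) (R' := R') (f := 𝟙 Y) (g := g)
    (fun y x => (h y x).1) (β := β) (α := α)
  rw [map_id_apply] at h1 h2
  exact ⟨h2, h1⟩

end exact

/-! ### Finite supports and bases for `T^∂`. -/

section support

/-- The inclusion between subposets. -/
abbrev subIncl {X : PartOrd.{u}} {S S' : Set X} (h : S ⊆ S') : subPos S ⟶ subPos S' :=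
  PartOrd.ofHom { toFun := fun x => ⟨x.1, h x.2⟩, monotone' := fun _ _ h => h }

theorem MemSub.mono {F : PartOrd.{u} ⥤ PartOrd.{u}} {X : PartOrd.{u}} {α : F.obj X}
    {S S' : Set X} (h : MemSub F α S) (hS : S ⊆ S') : MemSub F α S' := by
  obtain ⟨w, rfl⟩ := h
  exact ⟨F.map (subIncl hS) w, (map_comp_apply F (subIncl hS) (incl S') w).symm⟩

theorem isOrderEmb_incl {X : PartOrd.{u}} (S : Set X) : IsOrderEmb (incl S) := fun _ _ h => h

theorem isPullback_inter {X : PartOrd.{u}} (S S' : Set X) :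
    IsPullback (subIncl Set.inter_subset_left : subPos (S ∩ S') ⟶ subPos S)
      (subIncl Set.inter_subset_right : subPos (S ∩ S') ⟶ subPos S') (incl S) (incl S') := by
  refine ⟨⟨rfl⟩, ⟨PullbackCone.IsLimit.mk _ (fun s => PartOrd.ofHom
    { toFun := fun x => ⟨(s.fst x).1, (s.fst x).2, ?_⟩
      monotone' := fun _ _ h => s.fst.hom.monotone h }) ?_ ?_ ?_⟩⟩
  · have h : (s.fst x).1 = (s.snd x).1 :=
      congrArg (fun f : s.pt ⟶ X => f x) s.condition
    rw [h]
    exact (s.snd x).2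
  · intro s
    rfl
  · intro s
    ext x
    exact congrArg (fun f : s.pt ⟶ X => f x) s.condition
  · intro s m h1 h2
    ext x
    exact congrArg (fun f : s.pt ⟶ subPos S => (f x).1) h1

/-- Elements are maps out of the one-point poset, so the universal property yields the point. -/
theorem exists_of_isPullback {P A B C : PartOrd.{u}} {p₀ : P ⟶ A} {p₁ : P ⟶ B} {f : A ⟶ C}
    {g : B ⟶ C} (h : IsPullback p₀ p₁ f g) (a : A) (b : B) (hab : f a = g b) :
    ∃ w : P, p₀ w = a ∧ p₁ w = b := by
  let pt : PartOrd.{u} := PartOrd.of PUnit.{u + 1}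
  let a' : pt ⟶ A := PartOrd.ofHom (OrderHom.const _ a)
  let b' : pt ⟶ B := PartOrd.ofHom (OrderHom.const _ b)
  have hw : a' ≫ f = b' ≫ g := by ext; exact hab
  refine ⟨h.lift a' b' hw PUnit.unit, ?_, ?_⟩
  · exact congrArg (fun k : pt ⟶ A => k PUnit.unit) (h.lift_fst a' b' hw)
  · exact congrArg (fun k : pt ⟶ B => k PUnit.unit) (h.lift_snd a' b' hw)

/-- The diagram of finite subposets of a poset. -/
def finsetDiagram (X : PartOrd.{u}) : Finset X ⥤ PartOrd.{u} where
  obj s := subPos (s : Set X)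
  map h := PartOrd.ofHom
    { toFun := fun x => ⟨x.1, leOfHom h x.2⟩
      monotone' := fun _ _ h => h }

def finsetCocone (X : PartOrd.{u}) : Cocone (finsetDiagram X) where
  pt := X
  ι := { app := fun s => incl (s : Set X) }

theorem finsetCocone_app_eq {X : PartOrd.{u}} (c : Cocone (finsetDiagram X)) {s t : Finset X}
    (h : s ≤ t) (x : X) (hx : x ∈ s) :
    c.ι.app t (⟨x, h hx⟩ : subPos (t : Set X)) = c.ι.app s (⟨x, hx⟩ : subPos (s : Set X)) :=
  congrArg (fun f : subPos (s : Set X) ⟶ c.pt => f ⟨x, hx⟩) (c.w (homOfLE h))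

/-- Every poset is the colimit of its finite subposets. -/
noncomputable def finsetCoconeIsColimit (X : PartOrd.{u}) : IsColimit (finsetCocone X) where
  desc c := PartOrd.ofHom
    { toFun := fun x => c.ι.app {x} (⟨x, Finset.mem_singleton_self x⟩ : subPos _)
      monotone' := fun x y h => by
        classical
        change c.ι.app {x} (⟨x, Finset.mem_singleton_self x⟩ : subPos _) ≤
          c.ι.app {y} (⟨y, Finset.mem_singleton_self y⟩ : subPos _)
        -- The two values are compared in the common finite subposet `{x, y}`.
        have hx : ({x} : Finset X) ≤ {x, y} := by
          intro z hz; simp only [Finset.mem_singleton] at hz; simp [hz]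
        have hy : ({y} : Finset X) ≤ {x, y} := by
          intro z hz; simp only [Finset.mem_singleton] at hz; simp [hz]
        rw [← finsetCocone_app_eq c hx, ← finsetCocone_app_eq c hy]
        exact (c.ι.app {x, y}).hom.monotone h }
  fac c s := by
    ext x
    have hx : ({x.1} : Finset X) ≤ s := by
      intro z hz; simp only [Finset.mem_singleton] at hz; rw [hz]; exact x.2
    exact (finsetCocone_app_eq c hx x.1 (Finset.mem_singleton_self _)).symm
  uniq c m h := by
    ext x
    exact congrArg (fun f : subPos (({x} : Finset X) : Set X) ⟶ c.pt =>
      f ⟨x, Finset.mem_singleton_self x⟩) (h {x})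

variable (T : PartOrd.{u} ⥤ PartOrd.{u}) [hT : IsMossFunctor T]

/-- `T X` is the colimit of the `T S` for finite `S`. The elements with finite support form a
subposet `I` through which the colimit cocone factors, so the identity of `T X` factors through `I`
as well. -/
theorem exists_finite_memSub {X : PartOrd.{u}} (a : T.obj X) :
    ∃ S : Set X, S.Finite ∧ MemSub T a S := by
  classical
  have := hT.finitary
  have hc : IsColimit (T.mapCocone (finsetCocone X)) :=
    isColimitOfPreserves T (finsetCoconeIsColimit X)
  let I : Set (T.obj X) := {b | ∃ S : Set X, S.Finite ∧ MemSub T b S}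
  let c : Cocone (finsetDiagram X ⋙ T) :=
    { pt := subPos I
      ι :=
        { app := fun s => PartOrd.ofHom
            { toFun := fun w => ⟨T.map (incl (s : Set X)) w, s, s.finite_toSet, w, rfl⟩
              monotone' := fun _ _ h => (T.map (incl (s : Set X))).hom.monotone h }
          naturality := fun s t h => by
            ext w
            refine Subtype.ext ?_
            exact (map_comp_apply T ((finsetDiagram X).map h) (incl (t : Set X)) w).symm } }
  have h : hc.desc c ≫ incl I = 𝟙 (T.obj X) := by
    refine hc.hom_ext fun s => ?_
    have h1 := hc.fac c s
    rw [← Category.assoc, h1]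
    rfl
  have h2 : (hc.desc c a).1 = a := congrArg (fun f : T.obj X ⟶ T.obj X => f a) h
  rw [← h2]
  exact (hc.desc c a).2

theorem memSub_inter {X : PartOrd.{u}} {a : T.obj X} {S S' : Set X} (h : MemSub T a S)
    (h' : MemSub T a S') : MemSub T a (S ∩ S') := by
  obtain ⟨w, hw⟩ := h
  obtain ⟨w', hw'⟩ := h'
  obtain ⟨v, hv, -⟩ := exists_of_isPullback (hT.inter _ _ _ _ (isOrderEmb_incl S)
    (isOrderEmb_incl S') (isPullback_inter S S')) w w' (hw.trans hw'.symm)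
  refine ⟨v, ?_⟩
  rw [← hw, ← hv]
  exact map_comp_apply T (subIncl Set.inter_subset_left) (incl S) v

/-- A finite support of least cardinality is contained in every support `S'`: otherwise its
intersection with `S'` would be a smaller one. Only binary intersections are needed, although the
base is an arbitrary intersection. -/
theorem exists_least_memSub_dual {X : PartOrd.{u}} (α : (dualFunctor T).obj X) :
    ∃ S : Set X, S.Finite ∧ MemSub (dualFunctor T) α S ∧
      ∀ S', MemSub (dualFunctor T) α S' → S ⊆ S' := by
  obtain ⟨S₀, hS₀, h₀⟩ := exists_finite_memSub T (X := opPos X) (ofOp α)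
  obtain ⟨S, ⟨hS, hSα⟩, hmin⟩ := WellFounded.has_min
    (InvImage.wf (fun S : Set X => S.ncard) Nat.lt_wfRel.wf)
    {S : Set X | S.Finite ∧ MemSub (dualFunctor T) α S} ⟨S₀, hS₀, h₀⟩
  refine ⟨S, hS, hSα, fun S' h' => ?_⟩
  by_contra hsub
  refine hmin (S ∩ S') ⟨hS.inter_of_left S', memSub_inter T (X := opPos X) hSα h'⟩ ?_
  exact Set.ncard_lt_ncard ⟨Set.inter_subset_left, fun h => hsub fun x hx => (h hx).2⟩ hS

theorem base_dual_spec {X : PartOrd.{u}} (α : (dualFunctor T).obj X) :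
    (base (dualFunctor T) α).Finite ∧ MemSub (dualFunctor T) α (base (dualFunctor T) α) := by
  obtain ⟨S, hS, hα, hmin⟩ := exists_least_memSub_dual T α
  have : base (dualFunctor T) α = S :=
    Set.Subset.antisymm (Set.sInter_subset_of_mem hα) (Set.subset_sInter hmin)
  rw [this]
  exact ⟨hS, hα⟩

end support

end MossLogic

namespace MossLogic

/-! ### Bases after composing with `𝕌_ω` and `𝕃_ω`. -/

section support

variable {F : PartOrd.{u} ⥤ PartOrd.{u}}

/-- The minimal elements of a finitely generated upper set lie in every generating set, so a support
of `A` supports each of them. Hence the base of `A` is the finite union of their bases. -/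
theorem base_up_spec
    (hF : ∀ {X : PartOrd.{u}} (α : F.obj X), (base F α).Finite ∧ MemSub F α (base F α))
    {X : PartOrd.{u}} (A : (F ⋙ upFunctor).obj X) :
    (base (F ⋙ upFunctor) A).Finite ∧ MemSub (F ⋙ upFunctor) A (base (F ⋙ upFunctor) A) := by
  obtain ⟨s, hs, hA⟩ := A.2
  let M : Set (F.obj X) := {α | Minimal (· ∈ s) α}
  have hMs : M ⊆ s := fun α h => h.1
  have hM : M.Finite := hs.subset hMs
  have hAM : A.1 = upperClosure M := by
    rw [hA]
    refine le_antisymm (upperClosure_anti hMs) (le_upperClosure.2 fun α hα => ?_)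
    obtain ⟨m, hm, hmin⟩ := hs.exists_le_minimal hα
    exact mem_upperClosure.2 ⟨m, hmin, hm⟩
  have hsub : ∀ S, MemSub (F ⋙ upFunctor) A S → ∀ α ∈ M, MemSub F α S := by
    rintro S ⟨w, hw⟩ α hα
    have hw1 : upperClosure ((F.map (incl S)).hom '' (w.1 : Set (F.obj (subPos S)))) = A.1 :=
      congrArg Subtype.val hw
    have hαA : α ∈ A.1 := by rw [hA]; exact subset_upperClosure hα.1
    rw [← hw1] at hαA
    obtain ⟨_, ⟨γ, hγ, rfl⟩, hγα⟩ := mem_upperClosure.1 hαA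
    have hγA : (F.map (incl S)).hom γ ∈ A.1 := by
      rw [← hw1]; exact subset_upperClosure ⟨γ, hγ, rfl⟩
    rw [hA] at hγA
    obtain ⟨σ, hσ, hσγ⟩ := mem_upperClosure.1 hγA
    -- The generator `σ` satisfies `σ ≤ F(incl) γ ≤ α`, and minimality of `α` in `s` collapses the
    -- chain.
    exact ⟨γ, le_antisymm hγα ((hα.2 hσ (hσγ.trans hγα)).trans hσγ)⟩
  let V : Set X := ⋃ α ∈ M, base F α
  have hV : MemSub (F ⋙ upFunctor) A V := by
    have h : ∀ α ∈ M, MemSub F α V := fun α hα =>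
      (hF α).2.mono (Set.subset_biUnion_of_mem hα)
    choose g hg using h
    have := hM.to_subtype
    let t : Set (F.obj (subPos V)) := Set.range fun α : M => g α.1 α.2
    have ht : (F.map (incl V)).hom '' t = M := by
      rw [← Set.range_comp]
      exact (congrArg Set.range (funext fun α : M => hg α.1 α.2)).trans Subtype.range_coe
    refine ⟨⟨upperClosure t, t, Set.finite_range _, rfl⟩, Subtype.ext ?_⟩
    refine (upperClosure_image (F.map (incl V)).hom t).trans ?_
    rw [hAM, ht]
  have hbase : base (F ⋙ upFunctor) A = V :=
    Set.Subset.antisymm (Set.sInter_subset_of_mem hV) (Set.subset_sInter fun S hS =>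
      Set.iUnion₂_subset fun α hα => Set.sInter_subset_of_mem (hsub S hS α hα))
  rw [hbase]
  exact ⟨hM.biUnion fun α _ => (hF α).1, hV⟩

/-- Dual to `base_up_spec`, with maximal generators in place of minimal ones. -/
theorem base_low_spec
    (hF : ∀ {X : PartOrd.{u}} (α : F.obj X), (base F α).Finite ∧ MemSub F α (base F α))
    {X : PartOrd.{u}} (A : (F ⋙ lowFunctor).obj X) :
    (base (F ⋙ lowFunctor) A).Finite ∧ MemSub (F ⋙ lowFunctor) A (base (F ⋙ lowFunctor) A) := by
  obtain ⟨s, hs, hA⟩ := A.2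
  let M : Set (F.obj X) := {α | Maximal (· ∈ s) α}
  have hMs : M ⊆ s := fun α h => h.1
  have hM : M.Finite := hs.subset hMs
  have hAM : A.1 = lowerClosure M := by
    rw [hA]
    refine le_antisymm (lowerClosure_le.2 fun α hα => ?_) (lowerClosure_mono hMs)
    obtain ⟨m, hm, hmax⟩ := hs.exists_le_maximal hα
    exact mem_lowerClosure.2 ⟨m, hmax, hm⟩
  have hsub : ∀ S, MemSub (F ⋙ lowFunctor) A S → ∀ α ∈ M, MemSub F α S := by
    rintro S ⟨w, hw⟩ α hα
    have hw1 : lowerClosure ((F.map (incl S)).hom '' (w.1 : Set (F.obj (subPos S)))) = A.1 :=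
      congrArg Subtype.val hw
    have hαA : α ∈ A.1 := by rw [hA]; exact subset_lowerClosure hα.1
    rw [← hw1] at hαA
    obtain ⟨_, ⟨γ, hγ, rfl⟩, hγα⟩ := mem_lowerClosure.1 hαA
    have hγA : (F.map (incl S)).hom γ ∈ A.1 := by
      rw [← hw1]; exact subset_lowerClosure ⟨γ, hγ, rfl⟩
    rw [hA] at hγA
    obtain ⟨σ, hσ, hσγ⟩ := mem_lowerClosure.1 hγA
    exact ⟨γ, le_antisymm (hσγ.trans (hα.2 hσ (hγα.trans hσγ))) hγα⟩
  let V : Set X := ⋃ α ∈ M, base F α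
  have hV : MemSub (F ⋙ lowFunctor) A V := by
    have h : ∀ α ∈ M, MemSub F α V := fun α hα =>
      (hF α).2.mono (Set.subset_biUnion_of_mem hα)
    choose g hg using h
    have := hM.to_subtype
    let t : Set (F.obj (subPos V)) := Set.range fun α : M => g α.1 α.2
    have ht : (F.map (incl V)).hom '' t = M := by
      rw [← Set.range_comp]
      exact (congrArg Set.range (funext fun α : M => hg α.1 α.2)).trans Subtype.range_coe
    refine ⟨⟨lowerClosure t, t, Set.finite_range _, rfl⟩, Subtype.ext ?_⟩
    refine (lowerClosure_image (F.map (incl V)).hom t).trans ?_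
    rw [hAM, ht]
  have hbase : base (F ⋙ lowFunctor) A = V :=
    Set.Subset.antisymm (Set.sInter_subset_of_mem hV) (Set.subset_sInter fun S hS =>
      Set.iUnion₂_subset fun α hα => Set.sInter_subset_of_mem (hsub S hS α hα))
  rw [hbase]
  exact ⟨hM.biUnion fun α _ => (hF α).1, hV⟩

end support

/-! ### Invariance of truth under coalgebra morphisms. -/

section invariance

variable {T : PartOrd.{u} ⥤ PartOrd.{u}} {At : PartOrd.{u}}

/-- The negation of a relation `R : A ⇸ X^op` as a relation `X^op ⇸ A`. -/
def notRel {A X : PartOrd.{u}} (R : MonRel A (opPos X)) : MonRel (opPos X) A where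
  rel a x := ¬ R.rel x a
  mono h ha hx h' := h (R.mono h' hx ha)

/-- The graph of `negRel R` is the dual of the graph of `notRel R` with coordinates swapped, so a
witness in `T` of one is a witness in `T^∂` of the other. This expresses `Δ` through `T^∂`, on the
same footing as `∇`. -/
theorem negRel_lift_iff {A X : PartOrd.{u}} (R : MonRel A (opPos X)) (y : T.obj X)
    (β : (dualFunctor T).obj A) :
    ((negRel R).lift T).rel y (OrderDual.ofDual β) ↔
      ((notRel R).lift (dualFunctor T)).rel β (toOp y) := by
  constructor
  · rintro ⟨w, h1, h2⟩
    let k : (negRel R).graph ⟶ PartOrd.dual.obj (notRel R).graph := PartOrd.ofHom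
      { toFun := fun q => OrderDual.toDual ⟨(ofOp q.1.2, toOp q.1.1), q.2⟩
        monotone' := fun q q' h => ⟨h.2, h.1⟩ }
    exact ⟨T.map k w,
      (map_comp_apply T k (PartOrd.dual.map (incl _ ≫ prodFst _ _)) w).symm.trans_le h2,
      h1.trans_eq (map_comp_apply T k (PartOrd.dual.map (incl _ ≫ prodSnd _ _)) w)⟩
  · rintro ⟨w, h1, h2⟩
    let k : PartOrd.dual.obj (notRel R).graph ⟶ (negRel R).graph := PartOrd.ofHom
      { toFun := fun q => ⟨((OrderDual.ofDual q).1.2, (OrderDual.ofDual q).1.1),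
          (OrderDual.ofDual q).2⟩
        monotone' := fun q q' h => ⟨h.2, h.1⟩ }
    exact ⟨T.map k w,
      le_trans h2 (map_comp_apply T k (incl _ ≫ prodFst _ _) w).le,
      le_trans (map_comp_apply T k (incl _ ≫ prodSnd _ _) w).ge h1⟩

theorem deltaRel_iff (c : Coalgebra T) {A : PartOrd.{u}} (R : MonRel A (opPos c.V))
    (x : opPos c.V) (β : (dualFunctor T).obj A) :
    (deltaRel c R).rel x β ↔
      ¬ ((notRel R).lift (dualFunctor T)).rel β (PartOrd.dual.map c.str x) :=
  not_congr (negRel_lift_iff R _ _)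

/-- The structure of a coalgebra commutes with morphisms. -/
theorem dual_str_apply {c c' : Coalgebra T} (f : c ⟶ c') (x : opPos c.V) :
    PartOrd.dual.map c'.str (PartOrd.dual.map f.f x) =
      (dualFunctor T).map (PartOrd.dual.map f.f) (PartOrd.dual.map c.str x) :=
  congrArg (fun g : c.V ⟶ T.obj c'.V => g (ofOp x)) f.h.symm

/-- Inverse images of truth sets. -/
def preimageTruth {X Y : PartOrd.{u}} (f : X ⟶ Y) : truthSets Y ⟶ truthSets X :=
  PartOrd.ofHom
    { toFun := fun S => ⟨{x | PartOrd.dual.map f x ∈ S},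
        fun _ _ h hx => S.lower ((PartOrd.dual.map f).hom.monotone h) hx⟩
      monotone' := fun _ _ h _ hx => h hx }

theorem mem_preimageTruth {X Y : PartOrd.{u}} (f : X ⟶ Y) (S : truthSets Y) (x : opPos X) :
    (memTruth X).rel x (preimageTruth f S) ↔ (memTruth Y).rel (PartOrd.dual.map f x) S :=
  Iff.rfl

theorem interTruth_preimage {X Y : PartOrd.{u}} (f : X ⟶ Y) (φ : upFunctor.obj (truthSets Y)) :
    interTruth X (upFunctor.map (preimageTruth f) φ) = preimageTruth f (interTruth Y φ) := by
  refine LowerSet.ext (Set.ext fun x => ?_)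
  change x ∈ sInf {S : LowerSet (opPos X) |
    S ∈ upperClosure ((preimageTruth f).hom '' (φ.1 : Set (truthSets Y)))} ↔
    PartOrd.dual.map f x ∈ sInf {S : LowerSet (opPos Y) | S ∈ φ.1}
  refine LowerSet.mem_sInf_iff.trans (Iff.trans ?_ LowerSet.mem_sInf_iff.symm)
  constructor
  · intro h S hS
    exact h _ (subset_upperClosure ⟨S, hS, rfl⟩)
  · rintro h _ ⟨_, ⟨S, hS, rfl⟩, hS'⟩
    exact hS' (h S hS)

theorem unionTruth_preimage {X Y : PartOrd.{u}} (f : X ⟶ Y) (ψ : lowFunctor.obj (truthSets Y)) :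
    unionTruth X (lowFunctor.map (preimageTruth f) ψ) = preimageTruth f (unionTruth Y ψ) := by
  refine LowerSet.ext (Set.ext fun x => ?_)
  change x ∈ sSup {S : LowerSet (opPos X) |
    S ∈ lowerClosure ((preimageTruth f).hom '' (ψ.1 : Set (truthSets Y)))} ↔
    PartOrd.dual.map f x ∈ sSup {S : LowerSet (opPos Y) | S ∈ ψ.1}
  refine LowerSet.mem_sSup_iff.trans (Iff.trans ?_ LowerSet.mem_sSup_iff.symm)
  constructor
  · rintro ⟨_, ⟨_, ⟨S, hS, rfl⟩, hS'⟩, hx⟩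
    exact ⟨S, hS, hS' hx⟩
  · rintro ⟨S, hS, hx⟩
    exact ⟨_, subset_lowerClosure ⟨S, hS, rfl⟩, hx⟩

variable [hT : IsMossFunctor T]

/-- Restrict the relation along `g`, then push it along `f`; the morphism square identifies the
pushed `c(x)` with the structure of the image state. -/
theorem nablaRel_hom {c c' : Coalgebra T} (f : c ⟶ c') {A A' : PartOrd.{u}}
    (R : MonRel A (opPos c.V)) (R' : MonRel A' (opPos c'.V)) (g : A' ⟶ A)
    (h : ∀ x a, R.rel x (g a) ↔ R'.rel (PartOrd.dual.map f.f x) a) (x : opPos c.V)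
    (α : (dualFunctor T).obj A') :
    (nablaRel c R).rel x ((dualFunctor T).map g α) ↔
      (nablaRel c' R').rel (PartOrd.dual.map f.f x) α := by
  have h1 := MonRel.lift_right_iff (preservesExact_dual T) (R := R.restrict g) (R' := R)
    (g := g) (fun _ _ => Iff.rfl) (PartOrd.dual.map c.str x) α
  have h2 := MonRel.lift_left_iff (preservesExact_dual T) (R := R.restrict g) (R' := R')
    (f := PartOrd.dual.map f.f) (fun y a => (h y a).symm) (PartOrd.dual.map c.str x) α
  exact h1.trans (h2.symm.trans (iff_of_eq (congrArg
    (fun y => (R'.lift (dualFunctor T)).rel y α) (dual_str_apply f x).symm)))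

theorem deltaRel_hom {c c' : Coalgebra T} (f : c ⟶ c') {A A' : PartOrd.{u}}
    (R : MonRel A (opPos c.V)) (R' : MonRel A' (opPos c'.V)) (g : A' ⟶ A)
    (h : ∀ x a, R.rel x (g a) ↔ R'.rel (PartOrd.dual.map f.f x) a) (x : opPos c.V)
    (α : (dualFunctor T).obj A') :
    (deltaRel c R).rel x ((dualFunctor T).map g α) ↔
      (deltaRel c' R').rel (PartOrd.dual.map f.f x) α := by
  refine (deltaRel_iff c R x _).trans (Iff.trans (not_congr ?_) (deltaRel_iff c' R' _ α).symm)
  have h1 := MonRel.lift_left_iff (preservesExact_dual T)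
    (R := (notRel R).restrictLeft g) (R' := notRel R)
    (f := g) (fun _ _ => Iff.rfl) α (PartOrd.dual.map c.str x)
  have h2 := MonRel.lift_right_iff (preservesExact_dual T)
    (R := (notRel R).restrictLeft g) (R' := notRel R')
    (g := PartOrd.dual.map f.f) (fun a y => not_congr (h y a).symm) α (PartOrd.dual.map c.str x)
  exact h1.trans (h2.symm.trans (iff_of_eq (congrArg
    (fun y => ((notRel R').lift (dualFunctor T)).rel α y) (dual_str_apply f x).symm)))

/-- Inverse images along coalgebra morphisms preserve the semantics of the connectives. -/
def preimageHom {c c' : Coalgebra T} (f : c ⟶ c') (v : MonRel At (opPos c.V))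
    (v' : MonRel At (opPos c'.V))
    (hv : ∀ x p, v'.rel (PartOrd.dual.map f.f x) p ↔ v.rel x p) :
    semAlg c' v' ⟶ semAlg c v where
  f := preimageTruth f.f
  h := by
    refine PartOrd.ext ?_
    rintro (p | φ | ψ | α | β)
    · refine LowerSet.ext (Set.ext fun x => ?_)
      exact (hv x p).symm
    · exact interTruth_preimage f.f φ
    · exact unionTruth_preimage f.f ψ
    · refine LowerSet.ext (Set.ext fun x => ?_)
      exact nablaRel_hom f (memTruth c.V) (memTruth c'.V) (preimageTruth f.f)
        (fun x S => mem_preimageTruth f.f S x) x α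
    · refine LowerSet.ext (Set.ext fun x => ?_)
      exact deltaRel_hom f (memTruth c.V) (memTruth c'.V) (preimageTruth f.f)
        (fun x S => mem_preimageTruth f.f S x) x β

/-- Coalgebra morphisms preserve and reflect the truth of formulas. -/
theorem satRel_hom {c c' : Coalgebra T} (f : c ⟶ c') (v : MonRel At (opPos c.V))
    (v' : MonRel At (opPos c'.V))
    (hv : ∀ x p, v'.rel (PartOrd.dual.map f.f x) p ↔ v.rel x p) (x : opPos c.V)
    (a : Lang T At) :
    (satRel c' v').rel (PartOrd.dual.map f.f x) a ↔ (satRel c v).rel x a := by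
  -- Both sides are algebra morphisms out of the initial algebra.
  have h : (langAlgInitial T At).to (semAlg c' v') ≫ preimageHom f v v' hv =
      (langAlgInitial T At).to (semAlg c v) := (langAlgInitial T At).hom_ext _ _
  change _ ↔ (memTruth c.V).rel x (((langAlgInitial T At).to (semAlg c v)).f a)
  rw [← h]
  rfl

end invariance

end MossLogic

namespace MossLogic

/-! ### Refutation of the reduced sequent in terms of lifted relations. -/

section sequents

variable {T : PartOrd.{u} ⥤ PartOrd.{u}} [hT : IsMossFunctor T] {At : PartOrd.{u}}

theorem Sequent.refutedAt_iff (S : Sequent T At) (c : Coalgebra T)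
    (v : MonRel At (opPos c.V)) (x : c.V) :
    S.RefutedAt c v x ↔ (∀ a ∈ S.lhs.1, (satRel c v).rel (toOp x) a) ∧
      ∀ a ∈ S.rhs.1, ¬ (satRel c v).rel (toOp x) a := by
  unfold Sequent.RefutedAt
  rw [satRel_conj, satRel_disj]
  simp only [not_exists, not_and]

/-- Truth is upward closed in the formula, so only the generators `∇α` and `Δβ` matter. The negation
in the clause for `Δ` cancels against its failure, leaving the lifting of `⊮`. -/
theorem reducedSequent_refutedAt_iff (π : upFunctor.obj (Lang T At))
    (l : lowFunctor.obj (Lang T At)) (A : upFunctor.obj ((dualFunctor T).obj (Lang T At)))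
    (B : lowFunctor.obj ((dualFunctor T).obj (Lang T At))) (c : Coalgebra T)
    (v : MonRel At (opPos c.V)) (x : c.V) :
    (reducedSequent π l A B).RefutedAt c v x ↔ (Sequent.mk π l).RefutedAt c v x ∧
      (∀ α ∈ A.1, ((satRel c v).lift (dualFunctor T)).rel
        (PartOrd.dual.map c.str (toOp x)) α) ∧
      ∀ β ∈ B.1, ((notRel (satRel c v)).lift (dualFunctor T)).rel
        β (PartOrd.dual.map c.str (toOp x)) := by
  have hΔ : ∀ β, ¬ (satRel c v).rel (toOp x) (delta T At β) ↔
      ((notRel (satRel c v)).lift (dualFunctor T)).rel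
        β (PartOrd.dual.map c.str (toOp x)) := fun β => by
    rw [satRel_delta]
    exact (not_congr (deltaRel_iff c _ _ β)).trans not_not
  rw [Sequent.refutedAt_iff, Sequent.refutedAt_iff]
  constructor
  · rintro ⟨h1, h2⟩
    refine ⟨⟨fun a ha => h1 a (Or.inl ha), fun a ha => h2 a (Or.inr ha)⟩,
      fun α hα => ?_, fun β hβ => ?_⟩
    · exact (satRel_nabla c v _ α).1 (h1 _ (Or.inr (subset_upperClosure ⟨α, hα, rfl⟩)))
    · exact (hΔ β).1 (h2 _ (Or.inl (subset_lowerClosure ⟨β, hβ, rfl⟩)))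
  · rintro ⟨⟨h1, h2⟩, h3, h4⟩
    refine ⟨?_, ?_⟩
    · rintro a (ha | ha)
      · exact h1 a ha
      · obtain ⟨_, ⟨α, hα, rfl⟩, h⟩ := mem_upperClosure.1 ha
        exact (satRel c v).mono ((satRel_nabla c v _ α).2 (h3 α hα)) le_rfl h
    · rintro a (ha | ha)
      · obtain ⟨_, ⟨β, hβ, rfl⟩, h⟩ := mem_lowerClosure.1 ha
        exact fun h' => (hΔ β).2 (h4 β hβ) ((satRel c v).mono h' le_rfl h)
      · exact h2 a ha

end sequents

/-! ### From a refuting state to a redistribution. -/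

section soundness

/-- The formulas in the finite set `V` that hold in a state, together with those in the finite
set `W` that fail. -/
def theoryMap {L X : PartOrd.{u}} (R : MonRel L (opPos X)) {V W : Set L} (hV : V.Finite)
    (hW : W.Finite) :
    opPos X ⟶ prodPos (upFunctor.obj (subPos V)) (lowFunctor.obj (subPos W)) :=
  PartOrd.ofHom
    { toFun := fun y =>
        -- As `V` is finite, this upper set is finite and generates itself; likewise for `W` below.
        (⟨⟨{a : subPos V | R.rel y a.1}, fun _ _ h ha => R.mono ha le_rfl h⟩,
          {a : subPos V | R.rel y a.1}, by
            have := hV.to_subtype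
            exact Set.toFinite _, (UpperSet.upperClosure _).symm⟩,
        ⟨⟨{b : subPos W | ¬ R.rel y b.1}, fun _ _ h hb h' => hb (R.mono h' le_rfl h)⟩,
          {b : subPos W | ¬ R.rel y b.1}, by
            have := hW.to_subtype
            exact Set.toFinite _, (LowerSet.lowerClosure _).symm⟩)
      monotone' := fun _ _ h => ⟨fun _ ha => R.mono ha h le_rfl,
        fun _ hb h' => hb (R.mono h' h le_rfl)⟩ }

/-- The map `f` factors through its range, which is therefore a support. -/
theorem base_map_subset {F : PartOrd.{u} ⥤ PartOrd.{u}} {X Y : PartOrd.{u}} (f : X ⟶ Y)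
    (a : F.obj X) : base F (F.map f a) ⊆ Set.range f := by
  refine Set.sInter_subset_of_mem ?_
  let k : X ⟶ subPos (Set.range f) := PartOrd.ofHom
    { toFun := fun x => ⟨f x, x, rfl⟩
      monotone' := fun _ _ h => f.hom.monotone h }
  exact ⟨F.map k a, (map_comp_apply F k (incl _) a).symm⟩

variable {T : PartOrd.{u} ⥤ PartOrd.{u}} [hT : IsMossFunctor T] {At : PartOrd.{u}}

theorem exists_redistribution (π : upFunctor.obj (Lang T At))
    (l : lowFunctor.obj (Lang T At)) (A : upFunctor.obj ((dualFunctor T).obj (Lang T At)))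
    (B : lowFunctor.obj ((dualFunctor T).obj (Lang T At))) (c : Coalgebra T)
    (v : MonRel At (opPos c.V)) (x : c.V) (hx : (reducedSequent π l A B).RefutedAt c v x) :
    ∃ Φ : (dualFunctor T).obj
        (prodPos (upFunctor.obj (Lang T At)) (lowFunctor.obj (Lang T At))),
      IsRedistribution A B Φ ∧
        ∀ z ∈ base (dualFunctor T) Φ, (Sequent.mk z.1 z.2).Refutable := by
  obtain ⟨-, hA, hB⟩ := (reducedSequent_refutedAt_iff π l A B c v x).1 hx
  have hF := preservesExact_dual T
  obtain ⟨hV, wA, hwA⟩ := base_up_spec (F := dualFunctor T) (base_dual_spec T) A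
  obtain ⟨hW, wB, hwB⟩ := base_low_spec (F := dualFunctor T) (base_dual_spec T) B
  let R := satRel c v
  let ξ : (dualFunctor T).obj (opPos c.V) := PartOrd.dual.map c.str (toOp x)
  let θ := theoryMap R (V := baseUp A) (W := baseLow B) hV hW
  let ι := prodPosMap (upFunctor.map (incl (baseUp A))) (lowFunctor.map (incl (baseLow B)))
  refine ⟨(dualFunctor T).map (θ ≫ ι) ξ, ⟨⟨(dualFunctor T).map θ ξ,
    (map_comp_apply _ θ ι ξ).symm⟩, fun α hα => ?_, fun β hβ => ?_⟩, fun z hz => ?_⟩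
  · rw [← map_comp_apply]
    rw [← hwA] at hα
    -- `A` comes from `𝕌_ω T^∂ V`, so `α` lies above some element of `A` that comes from `T^∂ V`;
    -- there `⊩` is only needed on `V`, where truth at `y` means membership in the theory of `y`.
    obtain ⟨_, ⟨α₀, hα₀, rfl⟩, hle⟩ := mem_upperClosure.1 hα
    have hmem : (dualFunctor T).map (incl (baseUp A)) α₀ ∈ A.1 :=
      (congrArg (fun U : upFunctor.obj ((dualFunctor T).obj (Lang T At)) =>
        (dualFunctor T).map (incl (baseUp A)) α₀ ∈ U.1) hwA).mp
        (subset_upperClosure (Set.mem_image_of_mem _ hα₀))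
    have h1 := hA _ hmem
    refine ((memUp (Lang T At)).lift (dualFunctor T)).mono ?_ le_rfl hle
    refine MonRel.lift_map (R := R.restrict (incl (baseUp A))) (g := incl (baseUp A))
      (fun y a hya => show a.1 ∈ upperClosure ((incl (baseUp A)).hom ''
        {a : subPos (baseUp A) | R.rel y a.1}) from subset_upperClosure ⟨a, hya, rfl⟩) ?_
    exact (MonRel.lift_right_iff hF (fun _ _ => Iff.rfl) _ _).1 h1
  · rw [← map_comp_apply]
    rw [← hwB] at hβ
    obtain ⟨_, ⟨β₀, hβ₀, rfl⟩, hle⟩ := mem_lowerClosure.1 hβ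
    have hmem : (dualFunctor T).map (incl (baseLow B)) β₀ ∈ B.1 :=
      (congrArg (fun L : lowFunctor.obj ((dualFunctor T).obj (Lang T At)) =>
        (dualFunctor T).map (incl (baseLow B)) β₀ ∈ L.1) hwB).mp
        (subset_lowerClosure (Set.mem_image_of_mem _ hβ₀))
    have h1 := hB _ hmem
    refine ((memLow (Lang T At)).lift (dualFunctor T)).mono ?_ hle le_rfl
    refine MonRel.lift_map (R := (notRel R).restrictLeft (incl (baseLow B)))
      (f := incl (baseLow B)) (fun a y hya => show a.1 ∈ lowerClosure
        ((incl (baseLow B)).hom '' {a : subPos (baseLow B) | ¬ R.rel y a.1}) from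
          subset_lowerClosure ⟨a, hya, rfl⟩) ?_
    exact (MonRel.lift_left_iff hF (fun _ _ => Iff.rfl) _ _).1 h1
  -- Every point of the base is the theory of a state `y`, and `y` itself refutes it.
  · obtain ⟨y, rfl⟩ := base_map_subset _ _ hz
    refine ⟨c, v, ofOp y, (Sequent.refutedAt_iff _ c v _).2 ⟨fun a ha => ?_, fun b hb => ?_⟩⟩
    · obtain ⟨_, ⟨a', ha', rfl⟩, h⟩ := mem_upperClosure.1 ha
      exact R.mono ha' le_rfl h
    · obtain ⟨_, ⟨b', hb', rfl⟩, h⟩ := mem_lowerClosure.1 hb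
      exact fun h' => hb' (R.mono h' le_rfl h)

end soundness

/-! ### From a redistribution to a refuting state. -/

section completeness

variable {T : PartOrd.{u} ⥤ PartOrd.{u}}

def sigmaInj {ι : Type u} (X : ι → PartOrd.{u}) (i : ι) : X i ⟶ PartOrd.of (Σ i, X i) :=
  PartOrd.ofHom { toFun := fun x => ⟨i, x⟩, monotone' := fun _ _ h => Sigma.LE.fiber i _ _ h }

/-- The disjoint union of a family of coalgebras. -/
def sigmaCoalgebra {ι : Type u} (c : ι → Coalgebra T) : Coalgebra T where
  V := PartOrd.of (Σ i, (c i).V)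
  str := PartOrd.ofHom
    { toFun := fun p => T.map (sigmaInj (fun i => (c i).V) p.1) ((c p.1).str p.2)
      monotone' := by
        rintro _ _ ⟨i, a, b, h⟩
        exact (T.map (sigmaInj (fun i => (c i).V) i)).hom.monotone ((c i).str.hom.monotone h) }

def sigmaCoalgebraInj {ι : Type u} (c : ι → Coalgebra T) (i : ι) : c i ⟶ sigmaCoalgebra c where
  f := sigmaInj (fun i => (c i).V) i
  h := rfl

def sigmaValuation {ι : Type u} {c : ι → Coalgebra T} {At : PartOrd.{u}}
    (v : ∀ i, MonRel At (opPos (c i).V)) : MonRel At (opPos (sigmaCoalgebra c).V) where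
  rel x p := (v (ofOp x).1).rel (toOp (ofOp x).2) p
  mono := by
    rintro x x' p p' h hx hp
    change (ofOp x : Σ i, (c i).V) ≤ ofOp x' at hx
    obtain ⟨i, a, b, hab⟩ := hx
    exact (v i).mono h hab hp

/-- A coalgebra with an additional state, whose successor structure is `t`. -/
def pointCoalgebra (c : Coalgebra T) (t : T.obj c.V) : Coalgebra T where
  V := PartOrd.of (c.V ⊕ PUnit.{u + 1})
  str := PartOrd.ofHom
    { toFun := Sum.elim
        (fun x => T.map (PartOrd.ofHom ⟨Sum.inl, Sum.inl_mono⟩) (c.str x))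
        (fun _ => T.map (PartOrd.ofHom ⟨Sum.inl, Sum.inl_mono⟩) t)
      monotone' := by
        rintro _ _ (h | h)
        · exact (T.map _).hom.monotone (c.str.hom.monotone h)
        · exact le_rfl }

def pointCoalgebraInl (c : Coalgebra T) (t : T.obj c.V) : c ⟶ pointCoalgebra c t where
  f := PartOrd.ofHom ⟨Sum.inl, Sum.inl_mono⟩
  h := rfl

/-- The new state is incomparable to all others, so its atoms may be any upper set `P`. -/
def pointValuation {c : Coalgebra T} (t : T.obj c.V) {At : PartOrd.{u}}
    (v : MonRel At (opPos c.V)) (P : UpperSet At) :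
    MonRel At (opPos (pointCoalgebra c t).V) where
  rel x p := Sum.elim (fun y => v.rel (toOp y) p) (fun _ => p ∈ P) (ofOp x : c.V ⊕ PUnit.{u + 1})
  mono := by
    rintro x x' p p' h hx hp
    change (ofOp x : c.V ⊕ PUnit.{u + 1}) ≤ ofOp x' at hx
    revert h hx
    generalize (ofOp x : c.V ⊕ PUnit.{u + 1}) = y
    generalize (ofOp x' : c.V ⊕ PUnit.{u + 1}) = y'
    rintro h (hy | hy)
    · exact v.mono h hy hp
    · exact P.upper hp h

variable [hT : IsMossFunctor T] {At : PartOrd.{u}}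

theorem Sequent.RefutedAt.map {S : Sequent T At} {c c' : Coalgebra T}
    {v : MonRel At (opPos c.V)} {x : c.V} (h : S.RefutedAt c v x) (f : c ⟶ c')
    {v' : MonRel At (opPos c'.V)}
    (hv : ∀ x p, v'.rel (PartOrd.dual.map f.f x) p ↔ v.rel x p) :
    S.RefutedAt c' v' (f.f x) :=
  ⟨(satRel_hom f v v' hv (toOp x) _).2 h.1,
    fun h' => h.2 ((satRel_hom f v v' hv (toOp x) _).1 h')⟩

/-- Every element of `T^∂ X` comes from the disjoint union of the points of its base. -/
theorem exists_discrete_lift {X : PartOrd.{u}} (Φ : (dualFunctor T).obj X) :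
    ∃ (e : PartOrd.of (Σ _ : base (dualFunctor T) Φ, PUnit.{u + 1}) ⟶ X)
      (Φ' : (dualFunctor T).obj (PartOrd.of (Σ _ : base (dualFunctor T) Φ, PUnit.{u + 1}))),
      (∀ d, e d = d.1.1) ∧ (dualFunctor T).map e Φ' = Φ := by
  obtain ⟨w, hw⟩ := (base_dual_spec T Φ).2
  let d : PartOrd.of (Σ _ : base (dualFunctor T) Φ, PUnit.{u + 1}) ⟶
      subPos (base (dualFunctor T) Φ) := PartOrd.ofHom
    { toFun := fun z => z.1
      -- Only points of the same fibre are comparable in the sigma order, and the fibres are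
      -- singletons, so the domain is discrete.
      monotone' := by rintro _ _ ⟨z, _, _, _⟩; exact le_rfl }
  obtain ⟨Φ', hΦ'⟩ := (preservesExact_dual T).map_surjective d
    (fun z => ⟨⟨z, PUnit.unit⟩, rfl⟩) w
  refine ⟨d ≫ incl _, Φ', fun _ => rfl, ?_⟩
  rw [map_comp_apply, hΦ', hw]

theorem reducedSequent_refutable (π : upFunctor.obj (Lang T At))
    (l : lowFunctor.obj (Lang T At))
    (hπ : ∀ a ∈ π.1, ∃ p : At, a = atom T At p) (hl : ∀ a ∈ l.1, ∃ p : At, a = atom T At p)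
    (A : upFunctor.obj ((dualFunctor T).obj (Lang T At)))
    (B : lowFunctor.obj ((dualFunctor T).obj (Lang T At)))
    (h₀ : (Sequent.mk π l).Refutable)
    (Φ : (dualFunctor T).obj (prodPos (upFunctor.obj (Lang T At)) (lowFunctor.obj (Lang T At))))
    (hΦ : IsRedistribution A B Φ)
    (hbase : ∀ z ∈ base (dualFunctor T) Φ, (Sequent.mk z.1 z.2).Refutable) :
    (reducedSequent π l A B).Refutable := by
  obtain ⟨c₀, v₀, x₀, hx₀⟩ := h₀
  have hF := preservesExact_dual T
  choose c v x hx using fun z : base (dualFunctor T) Φ => hbase z.1 z.2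
  obtain ⟨e, Φ', he, hΦ'⟩ := exists_discrete_lift Φ
  -- The chosen refuting points; monotone only because the domain is discrete.
  let s : PartOrd.of (Σ _ : base (dualFunctor T) Φ, PUnit.{u + 1}) ⟶
      opPos (sigmaCoalgebra c).V := PartOrd.ofHom
    { toFun := fun d => toOp (X := (sigmaCoalgebra c).V) (⟨d.1, x d.1⟩ : Σ z, (c z).V)
      monotone' := by rintro _ _ ⟨z, _, _, _⟩; exact le_rfl }
  let t : T.obj (sigmaCoalgebra c).V := OrderDual.ofDual ((dualFunctor T).map s Φ')
  let c' := pointCoalgebra (sigmaCoalgebra c) t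
  -- The new state satisfies the same atoms as `x₀`. Other formulas may differ, which is harmless
  -- since `π` and `l` consist of atoms.
  let v' : MonRel At (opPos c'.V) := pointValuation t (sigmaValuation v)
    ⟨{p | v₀.rel (toOp x₀) p}, fun _ _ h hp => v₀.mono hp le_rfl h⟩
  let i : opPos (sigmaCoalgebra c).V ⟶ opPos c'.V :=
    PartOrd.dual.map (pointCoalgebraInl (sigmaCoalgebra c) t).f
  have hstr : (PartOrd.dual.map c'.str (toOp (Sum.inr PUnit.unit : c'.V)) :
      (dualFunctor T).obj (opPos c'.V)) = (dualFunctor T).map (s ≫ i) Φ' :=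
    (map_comp_apply (dualFunctor T) s i Φ').symm
  have href : ∀ d, (Sequent.mk (e d).1 (e d).2).RefutedAt c' v' (ofOp (i (s d))) := fun d => by
    rw [he d]
    exact ((hx d.1).map (sigmaCoalgebraInj c d.1) (v' := sigmaValuation v)
      (fun _ _ => Iff.rfl)).map (pointCoalgebraInl (sigmaCoalgebra c) t) (fun _ _ => Iff.rfl)
  have hatom : ∀ p, (satRel c' v').rel (toOp (Sum.inr PUnit.unit : c'.V)) (atom T At p) ↔
      (satRel c₀ v₀).rel (toOp x₀) (atom T At p) := fun p => by
    rw [satRel_atom, satRel_atom]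
    exact Iff.rfl
  rw [Sequent.refutedAt_iff] at hx₀
  refine ⟨c', v', Sum.inr PUnit.unit, (reducedSequent_refutedAt_iff π l A B c' v' _).2
    ⟨(Sequent.refutedAt_iff _ c' v' _).2 ⟨fun a ha => ?_, fun a ha => ?_⟩,
      fun α hα => ?_, fun β hβ => ?_⟩⟩
  · obtain ⟨p, rfl⟩ := hπ a ha
    exact (hatom p).2 (hx₀.1 _ ha)
  · obtain ⟨p, rfl⟩ := hl a ha
    exact fun h => hx₀.2 _ ha ((hatom p).1 h)
  · have h1 := hΦ.left α hα
    rw [← hΦ', ← map_comp_apply] at h1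
    -- Membership is pulled back to the discrete index poset; there `a` in the first component of `e
    -- d` forces `a` to hold at the point chosen for `d`, so the lifting passes on to `⊩`.
    have h2 := (MonRel.lift_left_iff hF
      (R := (memUp (Lang T At)).restrictLeft (e ≫ prodFst _ _)) (fun _ _ => Iff.rfl) Φ' α).1 h1
    have h3 := MonRel.lift_map (R' := satRel c' v') (f := s ≫ i) (g := 𝟙 _)
      (fun d a hda => ((Sequent.refutedAt_iff _ c' v' _).1 (href d)).1 a hda) h2
    rw [map_id_apply] at h3
    rwa [hstr]
  · have h1 := hΦ.right β hβ
    rw [← hΦ', ← map_comp_apply] at h1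
    have h2 := (MonRel.lift_right_iff hF
      (R := (memLow (Lang T At)).restrict (e ≫ prodSnd _ _)) (fun _ _ => Iff.rfl) β Φ').1 h1
    have h3 := MonRel.lift_map (R' := notRel (satRel c' v')) (f := 𝟙 _) (g := s ≫ i)
      (fun b d hbd => ((Sequent.refutedAt_iff _ c' v' _).1 (href d)).2 b hbd) h2
    rw [map_id_apply] at h3
    rwa [hstr]

end completeness

end MossLogic

theorem mainTheorem3 (T : CategoryTheory.Functor PartOrd.{u} PartOrd.{u}) [IsMossFunctor T]
    (At : PartOrd.{u})
    (π : upFunctor.obj (Lang T At)) (l : lowFunctor.obj (Lang T At))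
    (hπ : ∀ a ∈ π.1, ∃ p : At, a = atom T At p) (hl : ∀ a ∈ l.1, ∃ p : At, a = atom T At p)
    (A : upFunctor.obj ((dualFunctor T).obj (Lang T At)))
    (B : lowFunctor.obj ((dualFunctor T).obj (Lang T At))) :
    (reducedSequent π l A B).Refutable ↔
      (Sequent.mk π l).Refutable ∧
        ∃ Φ : (dualFunctor T).obj
            (prodPos (upFunctor.obj (Lang T At)) (lowFunctor.obj (Lang T At))),
          IsRedistribution A B Φ ∧
            ∀ z ∈ base (dualFunctor T) Φ, (Sequent.mk z.1 z.2).Refutable := by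
  constructor
  · rintro ⟨c, v, x, hx⟩
    exact ⟨⟨c, v, x, ((reducedSequent_refutedAt_iff π l A B c v x).1 hx).1⟩,
      exists_redistribution π l A B c v x hx⟩
  · rintro ⟨h₀, Φ, hΦ, hbase⟩
    exact reducedSequent_refutable π l hπ hl A B h₀ Φ hΦ hbase
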